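/- Conventions. A \emph{clutter} $\mathcal{C}$ over a finite ground set $V$ is a family of subsets of $V$ (its \emph{members}), none containing another. A \emph{cover} is a subset of $V$ that meets every member, a \emph{minimum cover} is a cover of minimum cardinality, and the \emph{blocker} of $\mathcal{C}$ is the clutter over $V$ of its inclusion-wise minimal covers. For disjoint $I,J\subseteq V$, the minor $\mathcal{C}\setminus I/J$ is the clutter over $V-(I\cup J)$ whose members are the inclusion-wise minimal sets of $\{C-J: C\in\mathcal{C},\ C\cap I=\emptyset\}$. A \emph{delta} is a clutter over a ground set $\{a_1,\dots,a_n\}$, $n\ge 3$, with members $\{a_2,\dots,a_n\}$ and $\{a_1,a_i\}$, $i=2,\dots,n$. An \emph{extended odd hole} is a clutter over a ground set $\{a_1,\dots,a_n\}$, $n\ge 5$ odd, whose members of minimum cardinality are exactly $\{a_1,a_2\},\{a_2,a_3\},\dots,\{a_{n-1},a_n\},\{a_n,a_1\}$. A clutter is \emph{clean} if no minor of it is a delta or the blocker of an extended odd hole; it is \emph{tangled} if its minimum covers have cardinality two and every element of $V$ lies in a minimum cover. For a clean tangled clutter $\mathcal{C}$, $G(\mathcal{C})$ is the graph on $V$ whose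 edges are the minimum covers (it is bipartite), and the \emph{rank} of $\mathcal{C}$ is its number of connected components. A \emph{fractional packing} of $\mathcal{C}$ is a vector $y\in\mathbb{R}^{\mathcal{C}}_{+}$ with $\sum(y_C: v\in C\in\mathcal{C})\le 1$ for every $v\in V$; its \emph{value} is $\sum_{C\in\mathcal{C}} y_C$. The clutter $\mathrm{core}(\mathcal{C})$ over $V$ consists of the members $C$ with $y_C>0$ for some fractional packing $y$ of value two. For $S\subseteq\{0,1\}^n$, $\mathrm{cuboid}(S)$ is the clutter over $[2n]$ whose members have incidence vectors $(p_1,1-p_1,\dots,p_n,1-p_n)$, $p\in S$. A clutter $\mathcal{D}$ is a \emph{duplication} of a clutter $\mathcal{C}'$ if, up to relabeling, it arises from $\mathcal{C}'$ by duplicating elements; that is, there is a surjection $f$ from the ground set of $\mathcal{D}$ onto the ground set of $\mathcal{C}'$ such that the members of $\mathcal{D}$ are the sets $f^{-1}(C')$, $C'\in\mathcal{C}'$. Two subsets of $\{0,1\}^n$ are \emph{isomorphic} if one is obtained from the other by permuting coordinates and twisting (replacing $x_i$ by $1-x_i$) some coordinates. \textbf{Theorem.} Let $\mathcal{C}$ be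 a clean tangled clutter of rank $r$. Then there exists a set $S\subseteq\{0,1\}^r$ such that the following statements hold: (i) $\mathrm{core}(\mathcal{C})$ is a duplication of $\mathrm{cuboid}(S)$, and, up to isomorphism, $S$ is the unique subset of $\{0,1\}^r$ with this property. (ii) There is a one-to-one correspondence between the fractional packings $y$ of $\mathcal{C}$ of value two and the ways $\alpha$ to express $\frac12\cdot\mathbf{1}$ as a convex combination $\sum_{p\in S}\alpha_p\, p$ of the points in $S$ (that is, $\alpha\in\mathbb{R}^S_+$, $\sum_{p\in S}\alpha_p=1$, $\sum_{p\in S}\alpha_p\,p=\frac12\cdot\mathbf{1}$). More precisely, for every surjection $f:V\to[2r]$ exhibiting $\mathrm{core}(\mathcal{C})$ as a duplication of $\mathrm{cuboid}(S)$, such a correspondence is given by $\alpha_p=\frac12\, y_{C_p}$, where $C_p=f^{-1}(C'_p)$ is the member of $\mathrm{core}(\mathcal{C})$ arising from the member $C'_p$ of $\mathrm{cuboid}(S)$ that belongs to $p$. (iii) $\mathrm{conv}(S)\subseteq\mathbb{R}^r$ is a full-dimensional polytope containing $\frac12\cdot\mathbf{1}$ in its interior. -/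

import Mathlib

/-- A clutter over the finite ground set `V`: a family of subsets of `V`, none of which contains
another one. -/
@[ext]
structure Clutter (V : Type*) where
  members : Finset (Finset V)
  antichain : IsAntichain (· ⊆ ·) (members : Set (Finset V))

namespace Clutter

noncomputable section

variable {V W : Type*} [Fintype V] [DecidableEq V] [Fintype W] [DecidableEq W]

/-- The clutter of inclusion-wise minimal sets of a family. -/
def ofMinimal (F : Finset (Finset V)) : Clutter V where
  members := by
    classical
    exact F.filter fun A => Minimal (· ∈ F) A
  antichain := by
    classical
    intro A hA B hB hne hAB
    rw [Finset.mem_coe, Finset.mem_filter] at hA hB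
    exact hne (Finset.Subset.antisymm hAB (hB.2.2 hA.1 hAB))

/-- A cover intersects every member at least once. -/
def IsCover (C : Clutter V) (B : Finset V) : Prop :=
  ∀ A ∈ C.members, (A ∩ B).Nonempty

/-- A minimum cover is a cover of minimum cardinality. -/
def IsMinimumCover (C : Clutter V) (B : Finset V) : Prop :=
  C.IsCover B ∧ ∀ B' : Finset V, C.IsCover B' → B.card ≤ B'.card

/-- The covering number `τ(C)`; it is `⊤` if there is no cover (that is, if `∅` is a member). -/
def coveringNumber (C : Clutter V) : ℕ∞ :=
  ⨅ (B : Finset V) (_ : C.IsCover B), (B.card : ℕ∞)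

/-- The blocker `b(C)`: the clutter of the minimal covers. -/
def blocker (C : Clutter V) : Clutter V :=
  ofMinimal (by
    classical
    exact Finset.univ.filter fun B => C.IsCover B)

/-- The minor `C \ I / J` obtained after deleting `I` and contracting `J`, for disjoint `I` and
`J`. It is a clutter over `V - (I ∪ J)`, with members the minimal sets among the sets `A - J`,
where `A` is a member disjoint from `I`. -/
def minor (C : Clutter V) (I J : Finset V) : Clutter {v : V // v ∉ I ∧ v ∉ J} :=
  ofMinimal ((C.members.filter fun A => Disjoint A I).image
    fun A => A.subtype fun v => v ∉ I ∧ v ∉ J)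

/-- A delta: a clutter over a ground set `{a₁, …, aₙ}`, `n ≥ 3`, with members `{a₂, …, aₙ}` and
`{a₁, aᵢ}` for `i = 2, …, n`. -/
def IsDelta (C : Clutter V) : Prop :=
  3 ≤ Fintype.card V ∧ ∃ a : V, ∀ A : Finset V,
    A ∈ C.members ↔ A = Finset.univ.erase a ∨ ∃ b, b ≠ a ∧ A = {a, b}

/-- An extended odd hole: a clutter over a ground set `{a₁, …, aₙ}`, with `n ≥ 5` odd, whose
members of minimum cardinality are `{a₁, a₂}, …, {aₙ₋₁, aₙ}, {aₙ, a₁}`. -/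
def IsExtendedOddHole (C : Clutter V) : Prop :=
  ∃ n : ℕ, 5 ≤ n ∧ Odd n ∧ ∃ a : ZMod n ≃ V, ∀ A : Finset V,
    (A ∈ C.members ∧ ∀ B ∈ C.members, A.card ≤ B.card) ↔ ∃ i : ZMod n, A = {a i, a (i + 1)}

/-- Clean: no minor is a delta or the blocker of an extended odd hole. -/
def IsClean (C : Clutter V) : Prop :=
  ∀ I J : Finset V, Disjoint I J →
    ¬ (C.minor I J).IsDelta ∧
    ¬ ∃ H : Clutter {v : V // v ∉ I ∧ v ∉ J}, H.IsExtendedOddHole ∧ C.minor I J = H.blocker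

/-- Tangled: the covering number is two and every element belongs to a minimum cover. -/
def IsTangled (C : Clutter V) : Prop :=
  C.coveringNumber = 2 ∧ ∀ v : V, ∃ B : Finset V, C.IsMinimumCover B ∧ v ∈ B

/-- The graph `G(C)` over the vertex set `V` whose edges are the minimum covers of `C`
(for tangled `C`, these are sets of cardinality two). -/
def coverGraph (C : Clutter V) : SimpleGraph V where
  Adj u v := u ≠ v ∧ C.IsMinimumCover {u, v}
  symm := ⟨fun u v h => ⟨h.1.symm, by rw [Finset.pair_comm]; exact h.2⟩⟩
  loopless := ⟨fun _ h => h.1 rfl⟩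

/-- The rank: the number of connected components of `G(C)`. -/
def rank (C : Clutter V) : ℕ := Nat.card C.coverGraph.ConnectedComponent

/-- Fractional packings: `y ≥ 0` with `∑ (y_A : v ∈ A ∈ C) ≤ 1` for every element `v`. -/
def IsFractionalPacking (C : Clutter V) (y : C.members → ℝ) : Prop :=
  (∀ A, 0 ≤ y A) ∧ ∀ v : V, ∑ A : C.members with v ∈ A.1, y A ≤ 1

/-- The set of the fractional packings of value two. -/
def packingsOfValueTwo (C : Clutter V) : Set (C.members → ℝ) :=
  {y | C.IsFractionalPacking y ∧ ∑ A, y A = 2}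

/-- The core: the members `A` with `y_A > 0` for some fractional packing `y` of value two. -/
def core (C : Clutter V) : Clutter V where
  members := by
    classical
    exact C.members.filter fun A => ∃ h : A ∈ C.members, ∃ y ∈ C.packingsOfValueTwo, 0 < y ⟨A, h⟩
  antichain := by
    classical
    exact C.antichain.subset (Finset.coe_subset.mpr (Finset.filter_subset _ _))

/-- `D` is obtained from `C` by duplicating elements, where `f` sends every element of `D` to the
element of `C` of which it is a copy: every element `w` of `C` has become the nonempty class
`f⁻¹(w)`, and every member `A` of `C` has become `f⁻¹(A)`. -/
def IsDuplicationVia (D : Clutter V) (C : Clutter W) (f : V → W) : Prop :=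
  Function.Surjective f ∧
    D.members = C.members.image fun A => Finset.univ.filter fun v => f v ∈ A

/-- `D` is (up to relabeling) a duplication of `C`. -/
def IsDuplication (D : Clutter V) (C : Clutter W) : Prop :=
  ∃ f : V → W, D.IsDuplicationVia C f

/-- The member of a cuboid that belongs to the point `p ∈ {0,1}ⁿ`. The ground set `[2n]` is
`Fin n × Bool`, with `(i, true)` and `(i, false)` in the roles of the `i`-th odd and the `i`-th even
element, so that the incidence vector is `(p₁, 1 - p₁, …, pₙ, 1 - pₙ)`. -/
def cuboidMember {n : ℕ} (p : Fin n → Bool) : Finset (Fin n × Bool) :=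
  Finset.univ.filter fun x => p x.1 = x.2

/-- The clutter `cuboid(S)`. -/
def cuboid {n : ℕ} (S : Finset (Fin n → Bool)) : Clutter (Fin n × Bool) where
  members := S.image cuboidMember
  antichain := by
    intro A hA B hB hne hAB
    simp only [Finset.coe_image, Set.mem_image, Finset.mem_coe] at hA hB
    obtain ⟨p, -, rfl⟩ := hA
    obtain ⟨q, -, rfl⟩ := hB
    apply hne
    have hpq : p = q := by
      funext i
      have h : (i, p i) ∈ cuboidMember q := hAB (by simp [cuboidMember])
      have h' : q i = p i := by simpa [cuboidMember] using h
      exact h'.symm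
    rw [hpq]

end

end Clutter

/-- `S₁ ≅ S₂`: one is obtained from the other by relabeling and twisting some coordinates. -/
def CubeIsomorphic {n : ℕ} (S₁ S₂ : Finset (Fin n → Bool)) : Prop :=
  ∃ (σ : Equiv.Perm (Fin n)) (q : Fin n → Bool),
    S₂ = S₁.image fun p i => xor (p (σ i)) (q i)

/-- A point of `{0,1}ⁿ` as a point of `ℝⁿ`. -/
def cubePoint {n : ℕ} (p : Fin n → Bool) : Fin n → ℝ := fun i => if p i then 1 else 0

/-- The polytope `conv(S)`. -/
def cubeHull {n : ℕ} (S : Finset (Fin n → Bool)) : Set (Fin n → ℝ) :=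
  convexHull ℝ (cubePoint '' (S : Set (Fin n → Bool)))

/-- The ways to express `½ · 1` as a convex combination of the points in `S`. -/
def centerCombinations {n : ℕ} (S : Finset (Fin n → Bool)) : Set (S → ℝ) :=
  {α | (∀ p, 0 ≤ α p) ∧ ∑ p, α p = 1 ∧ ∑ p : S, α p • cubePoint p.1 = fun _ => (1 / 2 : ℝ)}

/-!
Everything is phrased in terms of covers. The covers of the minor of `C` that arises by deleting
`I` and keeping the ground set `W` are the sets `T ⊆ W` for which `T ∪ I` is a cover of `C`
(`isCover_minor`). A delta is its own blocker and taking blockers is an involution, so a clean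
clutter is one in which no pair `(W, I)` has the covers of a delta (`IsClean.not_delta_covers`) or
minimum covers that form an odd hole (`IsClean.not_oddHole_covers`).

In a minor of covering number at least two, a shortest odd closed walk in the graph of the
two-element covers would be a triangle, hence a delta, or an odd hole. So this graph is bipartite
(`IsClean.minorGraph_colorable`). The combinatorial heart is `IsClean.not_cover_of_even`: if this
graph is connected, then no minimal cover lies on one side of its bipartition. It follows that the
covering number stays at least two when one side of a component is deleted and the other side is
contracted (`IsClean.noSmallCover_outside`).

Splitting off the components of the successive minors in this way, always contracting the heavier
side, one finds for every weight function on the elements a member that consists of one side of each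
component and carries at least half of the weight, and more than half of it if the weights do not
balance on the first component (`IsClean.exists_isStableMember_pos`). Let `S` be the set of the cube
points whose unions of sides are members of `C`. Then every nonzero functional is larger than at the
center at some point of `S` (`IsSideLabeling.isCentered`), and by separation the center is an
interior point of `conv(S)`. In particular every point of `S` has positive weight in some convex
combination of the center.

A fractional packing of value two is tight on the two-element covers, so its support consists of
unions of sides, and halving it gives a convex combination of the center. Conversely every convex
combination of the center, doubled, is a packing of value two. Hence the core consists of the unions
of sides given by `S`. The uniqueness of `S` holds because any two coordinates of `S` take all four
pairs of values (`IsCentered.exists_eq_eq`), so a duplication of `cuboid(S)` determines the elements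
of the cuboid and their pairing.
-/

/-! ### Minors and cleanness in terms of covers -/

namespace Clutter

variable {V : Type*} [Fintype V] [DecidableEq V]

omit [Fintype V] in
lemma IsCover.mono {C : Clutter V} {B B' : Finset V} (h : C.IsCover B) (hB : B ⊆ B') :
    C.IsCover B' := fun A hA => (h A hA).mono (Finset.inter_subset_inter_left hB)

/-- A set contains a member if and only if its complement is not a cover. -/
lemma not_isCover_compl_iff {C : Clutter V} {A : Finset V} :
    ¬ C.IsCover Aᶜ ↔ ∃ B ∈ C.members, B ⊆ A := by
  simp only [IsCover, not_forall, Finset.not_nonempty_iff_eq_empty, exists_prop]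
  refine exists_congr fun B => and_congr_right fun _ => ?_
  rw [← Finset.disjoint_iff_inter_eq_empty, disjoint_compl_right_iff]

omit [Fintype V] in
lemma eq_of_subset {C : Clutter V} {A B : Finset V} (hA : A ∈ C.members) (hB : B ∈ C.members)
    (h : A ⊆ B) : A = B := by
  by_contra hne
  exact C.antichain hA hB hne h

omit [Fintype V] [DecidableEq V] in
lemma mem_ofMinimal {F : Finset (Finset V)} {A : Finset V} :
    A ∈ (ofMinimal F).members ↔ Minimal (· ∈ F) A := by
  simp only [ofMinimal, Finset.mem_filter, and_iff_right_iff_imp]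
  exact fun h => h.1

omit [Fintype V] [DecidableEq V] in
lemma exists_mem_ofMinimal_subset {F : Finset (Finset V)} {A : Finset V} (hA : A ∈ F) :
    ∃ B ∈ (ofMinimal F).members, B ⊆ A := by
  obtain ⟨B, hBA, hB⟩ := F.exists_le_minimal hA
  exact ⟨B, mem_ofMinimal.2 hB, hBA⟩

omit [Fintype V] in
lemma isCover_ofMinimal {F : Finset (Finset V)} {T : Finset V} :
    (ofMinimal F).IsCover T ↔ ∀ A ∈ F, (A ∩ T).Nonempty := by
  refine ⟨fun h A hA => ?_, fun h A hA => h A (mem_ofMinimal.1 hA).1⟩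
  obtain ⟨B, hB, hBA⟩ := exists_mem_ofMinimal_subset hA
  exact (h B hB).mono (Finset.inter_subset_inter_right hBA)

omit [Fintype V] in
/-- The covers of the minor `C \ I / J` are the sets that become covers of `C` once `I` is added. -/
lemma isCover_minor {C : Clutter V} {I J : Finset V}
    {T : Finset {v : V // v ∉ I ∧ v ∉ J}} :
    (C.minor I J).IsCover T ↔ C.IsCover (T.map (Function.Embedding.subtype _) ∪ I) := by
  rw [minor, isCover_ofMinimal]
  simp only [Finset.mem_image, Finset.mem_filter, forall_exists_index, and_imp]
  constructor
  · intro h A hA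
    by_cases hd : Disjoint A I
    · obtain ⟨x, hx⟩ := h _ A hA hd rfl
      rw [Finset.mem_inter, Finset.mem_subtype] at hx
      refine ⟨x, ?_⟩
      rw [Finset.mem_inter, Finset.mem_union]
      exact ⟨hx.1, Or.inl (Finset.mem_map_of_mem _ hx.2)⟩
    · obtain ⟨x, hx, hx'⟩ := Finset.not_disjoint_iff.1 hd
      exact ⟨x, by simp [hx, hx']⟩
  · rintro h _ A hA hd rfl
    obtain ⟨x, hx⟩ := h A hA
    rw [Finset.mem_inter, Finset.mem_union] at hx
    obtain ⟨hxA, hx | hx⟩ := hx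
    · obtain ⟨y, hy, rfl⟩ := Finset.mem_map.1 hx
      exact ⟨y, by rw [Finset.mem_inter, Finset.mem_subtype]; exact ⟨hxA, hy⟩⟩
    · exact absurd hx (Finset.disjoint_left.1 hd hxA)

lemma mem_blocker {C : Clutter V} {B : Finset V} : B ∈ C.blocker.members ↔ Minimal C.IsCover B := by
  rw [blocker, mem_ofMinimal]
  simp

lemma isCover_blocker {C : Clutter V} {A : Finset V} :
    C.blocker.IsCover A ↔ ∃ B ∈ C.members, B ⊆ A := by
  rw [blocker, isCover_ofMinimal, ← not_isCover_compl_iff]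
  simp only [Finset.mem_filter, Finset.mem_univ, true_and]
  constructor
  · intro h h'
    obtain ⟨x, hx⟩ := h _ h'
    simp at hx
  · intro h T hT
    by_contra hTA
    refine h (hT.mono fun x hx => ?_)
    rw [Finset.mem_compl]
    exact fun hxA => hTA ⟨x, Finset.mem_inter.2 ⟨hx, hxA⟩⟩

/-- The blocker of the blocker is the clutter itself. -/
lemma blocker_blocker (C : Clutter V) : C.blocker.blocker = C := by
  ext A
  rw [mem_blocker]
  constructor
  · rintro ⟨h1, h2⟩
    obtain ⟨B, hB, hBA⟩ := isCover_blocker.1 h1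
    have := h2 (isCover_blocker.2 ⟨B, hB, subset_rfl⟩) hBA
    rwa [Finset.Subset.antisymm this hBA]
  · intro hA
    refine ⟨isCover_blocker.2 ⟨A, hA, subset_rfl⟩, fun B hB hBA => ?_⟩
    obtain ⟨D, hD, hDB⟩ := isCover_blocker.1 hB
    have := eq_of_subset hD hA (hDB.trans hBA)
    rwa [this] at hDB

/-- A clutter that has the covers of a delta is this delta: a delta is its own blocker. -/
lemma isDelta_of_isCover {M : Clutter V} (a : V) (hcard : 3 ≤ Fintype.card V)
    (h : ∀ T, M.IsCover T ↔ Finset.univ.erase a ⊆ T ∨ a ∈ T ∧ ∃ b, b ≠ a ∧ b ∈ T) :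
    M.IsDelta := by
  have key : ∀ A : Finset V, (∃ B ∈ M.members, B ⊆ A) ↔
      (∃ b, b ≠ a ∧ b ∈ A) ∧ (a ∈ A ∨ ∀ b, b ≠ a → b ∈ A) := by
    intro A
    rw [← not_isCover_compl_iff, h]
    simp only [Finset.subset_iff, Finset.mem_erase, Finset.mem_univ, and_true, Finset.mem_compl]
    grind
  have hD : ∀ B ∈ M.members, B ⊆ Finset.univ.erase a → B = Finset.univ.erase a := by
    intro B hB hBA
    refine hBA.antisymm fun b hb => ?_
    obtain ⟨-, h2⟩ := (key B).1 ⟨B, hB, subset_rfl⟩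
    grind
  have hpair : ∀ B ∈ M.members, ∀ b, b ≠ a → B ⊆ {a, b} → B = {a, b} := by
    intro B hB b hb hBA
    obtain ⟨⟨b', hb', hbB⟩, h2⟩ := (key B).1 ⟨B, hB, subset_rfl⟩
    -- a third element rules out the member `univ.erase a = {b}`
    obtain ⟨c, hc⟩ : ∃ c, c ∉ ({a, b} : Finset V) := by
      by_contra! hc
      have := Finset.card_le_card (fun x _ => hc x : Finset.univ ⊆ ({a, b} : Finset V))
      have h2 := Finset.card_le_two (a := a) (b := b)
      rw [Finset.card_univ] at this
      omega
    refine hBA.antisymm fun x hx => ?_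
    have := hBA hbB
    grind
  refine ⟨hcard, a, fun A => ⟨fun hA => ?_, ?_⟩⟩
  · obtain ⟨⟨b, hb, hbA⟩, haA | hall⟩ := (key A).1 ⟨A, hA, subset_rfl⟩
    · right
      refine ⟨b, hb, ?_⟩
      obtain ⟨B, hB, hBA⟩ := (key {a, b}).2 ⟨⟨b, hb, by simp⟩, Or.inl (by simp)⟩
      have h1 := hpair B hB b hb hBA
      subst h1
      exact (eq_of_subset hB hA (by simp [Finset.insert_subset_iff, haA, hbA])).symm
    · left
      obtain ⟨B, hB, hBA⟩ := (key (Finset.univ.erase a)).2 (by simp; exact ⟨b, hb⟩)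
      have h1 := hD B hB hBA
      subst h1
      exact (eq_of_subset hB hA fun x hx => hall x (by simpa using hx)).symm
  · rintro (rfl | ⟨b, hb, rfl⟩)
    · obtain ⟨b, hb⟩ : ∃ b, b ≠ a := by
        have : 1 < Fintype.card V := by omega
        have := Fintype.one_lt_card_iff_nontrivial.1 this
        exact exists_ne a
      obtain ⟨B, hB, hBA⟩ := (key (Finset.univ.erase a)).2 (by simp; exact ⟨b, hb⟩)
      rwa [← hD B hB hBA]
    · obtain ⟨B, hB, hBA⟩ := (key {a, b}).2 ⟨⟨b, hb, by simp⟩, Or.inl (by simp)⟩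
      rwa [← hpair B hB b hb hBA]

/-- Cleanness in terms of covers: no minor has the covers of a delta. -/
lemma IsClean.not_delta_covers {C : Clutter V} (hC : C.IsClean) {I D : Finset V} {a : V}
    (haD : a ∉ D) (haI : a ∉ I) (hDI : Disjoint D I) (hD : 2 ≤ D.card)
    (h : ∀ T ⊆ insert a D, C.IsCover (T ∪ I) ↔ D ⊆ T ∨ a ∈ T ∧ ∃ b ∈ D, b ∈ T) : False := by
  -- delete `I` and contract everything outside `I ∪ insert a D`
  set J : Finset V := (I ∪ insert a D)ᶜ with hJ
  have hIJ : Disjoint I J := disjoint_compl_right.mono_left Finset.subset_union_left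
  have hmem : ∀ v, (v ∉ I ∧ v ∉ J) ↔ v ∈ insert a D := by
    intro v
    have := fun h : v ∈ D => Finset.disjoint_left.1 hDI h
    simp only [hJ, Finset.mem_compl, Finset.mem_union, Finset.mem_insert]
    grind
  refine (hC I J hIJ).1 (isDelta_of_isCover ⟨a, (hmem a).2 (by simp)⟩ ?_ ?_)
  · rw [Fintype.card_of_subtype (insert a D) (fun x => (hmem x).symm),
      Finset.card_insert_of_notMem haD]
    omega
  · intro T
    rw [isCover_minor, h]
    · have hT : ∀ v (hv : v ∉ I ∧ v ∉ J),
          v ∈ T.map (Function.Embedding.subtype _) ↔ (⟨v, hv⟩ : {v : V // v ∉ I ∧ v ∉ J}) ∈ T :=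
        fun v hv => Finset.mem_map' (Function.Embedding.subtype _) (a := ⟨v, hv⟩)
      have hD' : ∀ v, v ∈ D ↔ v ≠ a ∧ (v ∉ I ∧ v ∉ J) := by
        intro v
        rw [hmem, Finset.mem_insert]
        grind
      refine or_congr ⟨fun h1 x hx => ?_, fun h1 x hx => ?_⟩
        (and_congr (hT _ _) ⟨fun h1 => ?_, fun h1 => ?_⟩)
      · have hxa : x.1 ≠ a := fun h => by simp [← h] at hx
        exact (hT _ x.2).1 (h1 ((hD' _).2 ⟨hxa, x.2⟩))
      · have hx' := (hD' x).1 hx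
        exact (hT x hx'.2).2 (h1 (by simpa using hx'.1))
      · obtain ⟨b, hb, hbT⟩ := h1
        have hb' := (hD' b).1 hb
        exact ⟨⟨b, hb'.2⟩, by simpa using hb'.1, (hT _ _).1 hbT⟩
      · obtain ⟨b, hb, hbT⟩ := h1
        exact ⟨b, (hD' b).2 ⟨fun h => hb (Subtype.ext h), b.2⟩, (hT _ b.2).2 hbT⟩
    · intro x hx
      obtain ⟨y, -, rfl⟩ := Finset.mem_map.1 hx
      exact (hmem y).1 y.2

/-- Cleanness in terms of covers: the minimum covers of a minor do not form an odd hole. -/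
lemma IsClean.not_oddHole_covers {C : Clutter V} (hC : C.IsClean) {I : Finset V} {n : ℕ}
    (hn : 5 ≤ n) (hodd : Odd n) {a : ZMod n → V} (ha : Function.Injective a) (haI : ∀ i, a i ∉ I)
    (h1 : ∀ i, ¬ C.IsCover ({a i} ∪ I))
    (h2 : ∀ i j, i ≠ j → (C.IsCover ({a i, a j} ∪ I) ↔ j = i + 1 ∨ i = j + 1)) : False := by
  have : NeZero n := ⟨by omega⟩
  have : Fact (1 < n) := ⟨by omega⟩
  set J : Finset V := (I ∪ Finset.univ.image a)ᶜ with hJ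
  have hIJ : Disjoint I J := disjoint_compl_right.mono_left Finset.subset_union_left
  have hmem : ∀ v, (v ∉ I ∧ v ∉ J) ↔ ∃ i, a i = v := by
    intro v
    simp only [hJ, Finset.mem_compl, Finset.mem_union, Finset.mem_image, Finset.mem_univ, true_and]
    grind
  refine (hC I J hIJ).2 ⟨(C.minor I J).blocker, ?_, (blocker_blocker _).symm⟩
  have hbij : Function.Bijective
      (fun i => (⟨a i, (hmem _).2 ⟨i, rfl⟩⟩ : {v : V // v ∉ I ∧ v ∉ J})) := by
    refine ⟨fun i j hij => ha (congrArg Subtype.val hij), fun ⟨v, hv⟩ => ?_⟩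
    obtain ⟨i, hi⟩ := (hmem v).1 hv
    exact ⟨i, Subtype.ext hi⟩
  set e := Equiv.ofBijective _ hbij with he
  have hev : ∀ i, (e i : V) = a i := fun i => rfl
  have hsub : ∀ B : Finset {v : V // v ∉ I ∧ v ∉ J}, (C.minor I J).IsCover B → 2 ≤ B.card := by
    intro B hB
    by_contra! hlt
    -- `x` absorbs the empty cover as well
    obtain ⟨x, hx⟩ : ∃ x, B ⊆ {x} := by
      rcases B.eq_empty_or_nonempty with rfl | hne
      · exact ⟨e 0, by simp⟩
      · obtain ⟨x, rfl⟩ := Finset.card_eq_one.1 (le_antisymm (by omega) hne.card_pos)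
        exact ⟨x, subset_rfl⟩
    have := (isCover_minor).1 (hB.mono hx)
    obtain ⟨i, rfl⟩ := e.surjective x
    exact h1 i (by simpa [hev] using this)
  have hedge : ∀ i j, i ≠ j →
      ((C.minor I J).IsCover {e i, e j} ↔ j = i + 1 ∨ i = j + 1) := by
    intro i j hij
    rw [isCover_minor, ← h2 i j hij]
    simp [hev]
  have hne : ∀ i : ZMod n, i ≠ i + 1 := fun i h => by simp at h
  refine ⟨n, hn, hodd, e, fun A => ⟨?_, ?_⟩⟩
  · rintro ⟨hA, hmin⟩
    have hA' := (mem_blocker.1 hA).1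
    have h01 : (C.minor I J).IsCover {e 0, e (0 + 1)} := (hedge _ _ (hne 0)).2 (Or.inl rfl)
    have hle : A.card ≤ 2 := by
      obtain ⟨B, hB, hBmin⟩ := exists_minimal_le_of_wellFoundedLT (C.minor I J).IsCover _ h01
      exact (hmin B (mem_blocker.2 hBmin)).trans ((Finset.card_le_card hB).trans Finset.card_le_two)
    obtain ⟨x, y, hxy, rfl⟩ := Finset.card_eq_two.1 (le_antisymm hle (hsub A hA'))
    obtain ⟨i, rfl⟩ := e.surjective x
    obtain ⟨j, rfl⟩ := e.surjective y
    rcases (hedge i j fun h => hxy (by rw [h])).1 hA' with rfl | rfl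
    · exact ⟨i, rfl⟩
    · exact ⟨j, Finset.pair_comm _ _⟩
  · rintro ⟨i, rfl⟩
    have hcov := (hedge i (i + 1) (hne i)).2 (Or.inl rfl)
    refine ⟨mem_blocker.2 ⟨hcov, fun B hB hBA => ?_⟩, fun B hB => ?_⟩
    · rw [Finset.eq_of_subset_of_card_le hBA (Finset.card_le_two.trans (hsub B hB))]
    · exact Finset.card_le_two.trans (hsub B (mem_blocker.1 hB).1)

end Clutter

/-! ### Bipartiteness of the graph of two-element covers -/

/-- A shortest odd closed walk of a graph that is not bipartite is an induced odd cycle. -/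
lemma SimpleGraph.exists_induced_odd_cycle {V : Type*} {G : SimpleGraph V} (h : ¬ G.Colorable 2) :
    ∃ n : ℕ, 3 ≤ n ∧ Odd n ∧ ∃ a : ZMod n → V, Function.Injective a ∧
      ∀ i j, G.Adj (a i) (a j) ↔ j = i + 1 ∨ i = j + 1 := by
  classical
  rw [SimpleGraph.two_colorable_iff_forall_loop_even] at h
  push Not at h
  have hex : ∃ n, ∃ u, ∃ w : G.Walk u u, w.length = n ∧ Odd n := by
    obtain ⟨u, w, hw⟩ := h
    exact ⟨_, u, w, rfl, Nat.not_even_iff_odd.1 hw⟩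
  obtain ⟨u, w, hwn, hodd⟩ := Nat.find_spec hex
  have hmin : ∀ v (p : G.Walk v v), Odd p.length → Nat.find hex ≤ p.length :=
    fun v p hp => Nat.find_min' hex ⟨v, p, rfl, hp⟩
  generalize Nat.find hex = n at hwn hodd hmin
  have hg0 : w.getVert n = w.getVert 0 := by rw [← hwn]; simp
  have hsucc : ∀ i < n, G.Adj (w.getVert i) (w.getVert (i + 1)) :=
    fun i hi => w.adj_getVert_succ (by omega)
  have hn3 : 3 ≤ n := by
    by_contra! hlt
    have h1 : n = 1 := by rcases hodd with ⟨k, hk⟩; omega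
    have := hsucc 0 (by omega)
    rw [zero_add, ← h1, hg0] at this
    exact this.ne rfl
  -- a repeated vertex splits the closed walk into two shorter ones, one of which is odd
  have hinj : ∀ i j, i < j → j < n → w.getVert i ≠ w.getVert j := by
    intro i j hij hj heq
    have h1 := hmin _ ((w.take i).append ((w.drop j).copy heq.symm rfl))
    have h2 := hmin _ (((w.drop i).take (j - i)).copy rfl
      (by rw [SimpleGraph.Walk.drop_getVert, Nat.add_sub_cancel' hij.le, heq]))
    simp only [SimpleGraph.Walk.length_append, SimpleGraph.Walk.take_length,
      SimpleGraph.Walk.length_copy, SimpleGraph.Walk.drop_length, hwn] at h1 h2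
    rw [Nat.odd_iff] at h1 h2 hodd
    omega
  -- a chord splits it into two closed walks of total length `n + 2`, one of which is odd
  have hchord : ∀ i j, i < j → j < n → G.Adj (w.getVert i) (w.getVert j) →
      j = i + 1 ∨ i = 0 ∧ j + 1 = n := by
    intro i j hij hj hadj
    have h1 := hmin _ ((w.take i).append (SimpleGraph.Walk.cons hadj (w.drop j)))
    have h2 := hmin _ (SimpleGraph.Walk.cons hadj.symm (((w.drop i).take (j - i)).copy rfl
      (by rw [SimpleGraph.Walk.drop_getVert, Nat.add_sub_cancel' hij.le])))
    simp only [SimpleGraph.Walk.length_append, SimpleGraph.Walk.take_length,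
      SimpleGraph.Walk.length_copy, SimpleGraph.Walk.drop_length, hwn,
      SimpleGraph.Walk.length_cons] at h1 h2
    rw [Nat.odd_iff] at h1 h2 hodd
    omega
  have : NeZero n := ⟨by omega⟩
  have : Fact (1 < n) := ⟨by omega⟩
  have hval : ∀ i : ZMod n, (i + 1).val = i.val + 1 ∧ i.val + 1 < n ∨
      (i + 1).val = 0 ∧ i.val + 1 = n := by
    intro i
    have hi := i.val_lt
    rw [ZMod.val_add, ZMod.val_one]
    rcases (by omega : i.val + 1 < n ∨ i.val + 1 = n) with h1 | h1
    · exact Or.inl ⟨Nat.mod_eq_of_lt h1, h1⟩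
    · exact Or.inr ⟨by rw [h1, Nat.mod_self], h1⟩
  have hadj : ∀ i : ZMod n, G.Adj (w.getVert i.val) (w.getVert (i + 1).val) := by
    intro i
    rcases hval i with ⟨h1, -⟩ | ⟨h1, h2⟩
    · rw [h1]
      exact hsucc _ i.val_lt
    · rw [h1, ← hg0]
      conv_rhs => rw [← h2]
      exact hsucc _ i.val_lt
  have hlt : ∀ i j : ZMod n, i.val < j.val → G.Adj (w.getVert i.val) (w.getVert j.val) →
      j = i + 1 ∨ i = j + 1 := by
    intro i j hij h
    have hj := j.val_lt
    rcases hchord _ _ hij hj h with h1 | ⟨h1, h2⟩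
    · left
      apply ZMod.val_injective n
      rcases hval i with h3 | h3 <;> omega
    · right
      apply ZMod.val_injective n
      rcases hval j with h3 | h3 <;> omega
  refine ⟨n, hn3, hodd, fun i => w.getVert i.val, fun i j hij => ?_, fun i j => ⟨fun h => ?_, ?_⟩⟩
  · apply ZMod.val_injective n
    rcases lt_trichotomy i.val j.val with h1 | h1 | h1
    · exact absurd hij (hinj _ _ h1 j.val_lt)
    · exact h1
    · exact absurd hij.symm (hinj _ _ h1 i.val_lt)
  · rcases lt_trichotomy i.val j.val with h1 | h1 | h1
    · exact hlt i j h1 h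
    · exact absurd (by simp only [h1]) h.ne
    · exact (hlt j i h1 h.symm).symm
  · rintro (rfl | rfl)
    · exact hadj i
    · exact (hadj j).symm

namespace Clutter

variable {V : Type*} [Fintype V] [DecidableEq V]

/-- In the minor of `C` over the ground set `W` that arises by deleting `I` and contracting all
other elements, every cover has at least two elements. -/
def NoSmallCover (C : Clutter V) (W I : Finset V) : Prop :=
  ∀ T ⊆ W, C.IsCover (T ∪ I) → 2 ≤ T.card

/-- The graph of the covers of cardinality two of the minor of `C` over the ground set `W` that
arises by deleting `I` and contracting all other elements. -/
def minorGraph (C : Clutter V) (W I : Finset V) : SimpleGraph V where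
  Adj u v := u ≠ v ∧ u ∈ W ∧ v ∈ W ∧ C.IsCover ({u, v} ∪ I)
  symm := ⟨fun u v h => ⟨h.1.symm, h.2.2.1, h.2.1, by rw [Finset.pair_comm]; exact h.2.2.2⟩⟩
  loopless := ⟨fun _ h => h.1 rfl⟩

omit [Fintype V] in
lemma NoSmallCover.ne {C : Clutter V} {W I : Finset V} (h : C.NoSmallCover W I) {u v : V}
    (hu : u ∈ W) (huv : C.IsCover ({u, v} ∪ I)) : u ≠ v := by
  rintro rfl
  have := h {u} (by simpa using hu) (by simpa using huv)
  simp at this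

omit [Fintype V] in
lemma NoSmallCover.mono {C : Clutter V} {W W' I : Finset V} (h : C.NoSmallCover W I)
    (hW : W' ⊆ W) : C.NoSmallCover W' I := fun T hT => h T (hT.trans hW)

/-- An induced triangle of covers is a delta on three elements, and a longer induced odd cycle is
an odd hole. -/
lemma IsClean.minorGraph_colorable {C : Clutter V} (hC : C.IsClean) {W I : Finset V}
    (hWI : Disjoint W I) (hs : C.NoSmallCover W I) : (C.minorGraph W I).Colorable 2 := by
  by_contra hcol
  obtain ⟨n, hn, hodd, a, ha, hadj⟩ := SimpleGraph.exists_induced_odd_cycle hcol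
  have : NeZero n := ⟨by omega⟩
  have : Fact (1 < n) := ⟨by omega⟩
  have haW : ∀ i, a i ∈ W := fun i => ((hadj i (i + 1)).2 (Or.inl rfl)).2.1
  have haI : ∀ i, a i ∉ I := fun i => Finset.disjoint_left.1 hWI (haW i)
  have hedge : ∀ i j, i ≠ j → (C.IsCover ({a i, a j} ∪ I) ↔ j = i + 1 ∨ i = j + 1) :=
    fun i j hij => ⟨fun h => (hadj i j).1 ⟨fun h => hij (ha h), haW i, haW j, h⟩,
      fun h => ((hadj i j).2 h).2.2.2⟩
  rcases (by rcases hodd with ⟨k, hk⟩; omega : n = 3 ∨ 5 ≤ n) with rfl | h5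
  · have h01 : C.IsCover ({a 0, a 1} ∪ I) := (hedge 0 1 (by decide)).2 (by decide)
    have h02 : C.IsCover ({a 0, a 2} ∪ I) := (hedge 0 2 (by decide)).2 (by decide)
    have h12 : C.IsCover ({a 1, a 2} ∪ I) := (hedge 1 2 (by decide)).2 (by decide)
    have n01 : a 0 ≠ a 1 := fun h => absurd (ha h) (by decide)
    have n02 : a 0 ≠ a 2 := fun h => absurd (ha h) (by decide)
    have n12 : a 1 ≠ a 2 := fun h => absurd (ha h) (by decide)
    refine hC.not_delta_covers (I := I) (D := {a 1, a 2}) (a := a 0) (by simp [n01, n02]) (haI 0)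
      (by simp [haI]) (by rw [Finset.card_pair n12]) fun T hT => ⟨fun h => ?_, ?_⟩
    · have hcard := hs T (fun x hx => by
        have := hT hx
        simp only [Finset.mem_insert, Finset.mem_singleton] at this
        rcases this with rfl | rfl | rfl <;> exact haW _) h
      obtain ⟨x, hx, y, hy, hxy⟩ := Finset.one_lt_card.1 hcard
      have hx' := hT hx
      have hy' := hT hy
      simp only [Finset.mem_insert, Finset.mem_singleton, Finset.insert_subset_iff,
        Finset.singleton_subset_iff] at hx' hy' ⊢
      grind
    · rintro (h | ⟨h0, b, hb, hbT⟩)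
      · exact h12.mono (Finset.union_subset_union_left h)
      · simp only [Finset.mem_insert, Finset.mem_singleton] at hb
        rcases hb with rfl | rfl
        · exact h01.mono (Finset.union_subset_union_left (by simp [Finset.insert_subset_iff, *]))
        · exact h02.mono (Finset.union_subset_union_left (by simp [Finset.insert_subset_iff, *]))
  · refine hC.not_oddHole_covers h5 hodd ha haI (fun i h => ?_) hedge
    have := hs {a i} (by simpa using haW i) h
    simp at this

end Clutter

/-! ### Minimal covers on one side of a connected bipartite graph -/

namespace Clutter

variable {V : Type*} [Fintype V] [DecidableEq V]

/-- Two covers `{a, f}` and `{a, g}` of cardinality two, together with a minimal cover that contains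
`f` and `g` but not `a`, give a delta minor: delete a maximal subset `X` of `D - {f, g}` for which
`X ∪ {a}` is not a cover. -/
lemma IsClean.not_cover_of_common_neighbor {C : Clutter V} (hC : C.IsClean) {I D : Finset V}
    {a f g : V} (haD : a ∉ D) (haI : a ∉ I) (hDI : Disjoint D I) (hf : f ∈ D) (hg : g ∈ D)
    (hfg : f ≠ g) (ha : ¬ C.IsCover ({a} ∪ I)) (haf : C.IsCover ({a, f} ∪ I))
    (hag : C.IsCover ({a, g} ∪ I)) (hD : C.IsCover (D ∪ I))
    (hmin : ∀ D' ⊂ D, ¬ C.IsCover (D' ∪ I)) : False := by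
  classical
  obtain ⟨X, -, hX⟩ := ((D \ {f, g}).powerset.filter
    fun X => ¬ C.IsCover (insert a X ∪ I)).exists_le_maximal (a := ∅) (by simpa using ha)
  have hXmem := hX.prop
  simp only [Finset.mem_filter, Finset.mem_powerset] at hXmem
  obtain ⟨hXD, hXc⟩ := hXmem
  have hXD' : X ⊆ D := hXD.trans Finset.sdiff_subset
  have hmax : ∀ b ∈ D, b ∉ X → C.IsCover ({a, b} ∪ (I ∪ X)) := by
    intro b hb hbX
    by_cases hbf : b = f
    · subst hbf
      exact haf.mono (by grind)
    by_cases hbg : b = g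
    · subst hbg
      exact hag.mono (by grind)
    by_contra hcov
    refine hbX (hX.le_of_ge (y := insert b X) ?_ (Finset.subset_insert b X)
      (Finset.mem_insert_self b X))
    simp only [Finset.mem_filter, Finset.mem_powerset]
    refine ⟨by grind, fun h => hcov (h.mono (by grind))⟩
  have hfX : f ∉ X := fun h => by have := hXD h; simp at this
  have hgX : g ∉ X := fun h => by have := hXD h; simp at this
  refine hC.not_delta_covers (I := I ∪ X) (D := D \ X) (a := a) (by grind) (by grind) ?_ ?_
    fun T hT => ⟨fun h => ?_, ?_⟩
  · rw [Finset.disjoint_union_right]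
    exact ⟨hDI.mono_left Finset.sdiff_subset, Finset.sdiff_disjoint⟩
  · exact Finset.one_lt_card.2 ⟨f, by simp [hf, hfX], g, by simp [hg, hgX], hfg⟩
  · by_cases haT : a ∈ T
    · right
      refine ⟨haT, ?_⟩
      by_contra! hno
      exact hXc (h.mono (by grind))
    · left
      intro x hx
      by_contra hxT
      have hx' := Finset.mem_sdiff.1 hx
      refine hmin (T ∪ X) ?_ (h.mono (by grind))
      rw [Finset.ssubset_iff_of_subset (by grind)]
      exact ⟨x, hx'.1, by grind⟩
  · rintro (h | ⟨haT, b, hb, hbT⟩)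
    · exact hD.mono (by grind)
    · have hb' := Finset.mem_sdiff.1 hb
      exact (hmax b hb'.1 hb'.2).mono (by grind)

/-- A certificate that the graph of the covers of cardinality two is connected on `W`: every vertex
other than the root `r` has a neighbor whose level `d` is one less. -/
def IsGraded (C : Clutter V) (W I : Finset V) (r : V) (d : V → ℕ) : Prop :=
  ∀ v ∈ W, v ≠ r → ∃ u ∈ W, C.IsCover ({u, v} ∪ I) ∧ d v = d u + 1

/-- The parity of the level is the two-coloring of the connected bipartite graph. -/
lemma IsClean.even_iff_not_even {C : Clutter V} (hC : C.IsClean) {W I : Finset V}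
    (hWI : Disjoint W I) (hs : C.NoSmallCover W I) {r : V} {d : V → ℕ}
    (hd : C.IsGraded W I r d) {u v : V} (hu : u ∈ W) (hv : v ∈ W)
    (huv : C.IsCover ({u, v} ∪ I)) : Even (d u) ↔ ¬ Even (d v) := by
  let c : (C.minorGraph W I).Coloring Bool := (hC.minorGraph_colorable hWI hs).toColoring (by simp)
  have hadj : ∀ x ∈ W, ∀ y ∈ W, C.IsCover ({x, y} ∪ I) → c x ≠ c y :=
    fun x hx y hy hxy => c.valid ⟨hs.ne hx hxy, hx, hy, hxy⟩
  have hbool : ∀ a b e : Bool, a ≠ b → (b = e ↔ ¬ a = e) := by decide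
  have key : ∀ n, ∀ x ∈ W, d x = n → (c x = c r ↔ (Even (d x) ↔ Even (d r))) := by
    intro n
    induction n with
    | zero =>
      intro x hx hn
      by_cases hxr : x = r
      · simp [hxr]
      · obtain ⟨y, -, -, h⟩ := hd x hx hxr
        omega
    | succ n ih =>
      intro x hx hn
      by_cases hxr : x = r
      · simp [hxr]
      · obtain ⟨y, hy, hxy, h⟩ := hd x hx hxr
        have h1 := ih y hy (by omega)
        have h2 := hadj y hy x hx hxy
        rw [hbool _ _ _ h2, h1, h, Nat.even_add_one]
        exact not_iff
  have h1 := key _ u hu rfl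
  have h2 := key _ v hv rfl
  rw [hbool _ _ _ (hadj u hu v hv huv), h1] at h2
  by_cases hP : Even (d u) <;> by_cases hQ : Even (d v) <;> by_cases hR : Even (d r) <;>
    simp [hP, hQ, hR] at h2 ⊢

/-- In a minor of a clean clutter whose graph of covers of cardinality two is connected, no minimal
cover lies on one side of the bipartition. The proof shrinks `W` while keeping a certificate of
connectedness: drop a vertex outside `D` of maximal level, or drop it together with its only child
`y ∈ D`, where `y` is deleted; two such children give a delta minor. -/
theorem IsClean.not_cover_of_even {C : Clutter V} (hC : C.IsClean) {W I D : Finset V} {r : V}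
    {d : V → ℕ} (hWI : Disjoint W I) (hs : C.NoSmallCover W I) (hd : C.IsGraded W I r d)
    (hDW : D ⊆ W) (hr : r ∈ D) (hD2 : 2 ≤ D.card) (hD : C.IsCover (D ∪ I))
    (hmin : ∀ D' ⊂ D, ¬ C.IsCover (D' ∪ I)) (heven : ∀ v ∈ D, Even (d v)) : False := by
  induction hn : W.card using Nat.strong_induction_on generalizing W I D d with
  | _ n ih =>
  have hpar : ∀ u ∈ W, ∀ v ∈ W, C.IsCover ({u, v} ∪ I) → (Even (d u) ↔ ¬ Even (d v)) :=
    fun u hu v hv => hC.even_iff_not_even hWI hs hd hu hv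
  -- `D` lies on one side of the bipartition
  have hDedge : ∀ u ∈ D, ∀ v ∈ D, ¬ C.IsCover ({u, v} ∪ I) := by
    intro u hu v hv huv
    have := hpar u (hDW hu) v (hDW hv) huv
    exact this.1 (heven u hu) (heven v hv)
  rcases eq_or_lt_of_le hD2 with h2 | h3
  · obtain ⟨a, b, -, rfl⟩ := Finset.card_eq_two.1 h2.symm
    exact hDedge a (by simp) b (by simp) hD
  -- no element of `W` above the level of `p` lies outside `D`
  obtain ⟨p, hp, hpmax⟩ : ∃ p ∈ W \ D, ∀ v ∈ W \ D, d v ≤ d p := by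
    apply Finset.exists_max_image
    obtain ⟨v, hv, hvr⟩ := Finset.exists_mem_ne (by omega : 1 < D.card) r
    obtain ⟨u, hu, huv, -⟩ := hd v (hDW hv) hvr
    exact ⟨u, Finset.mem_sdiff.2 ⟨hu, fun huD => hDedge u huD v hv huv⟩⟩
  obtain ⟨hpW, hpD⟩ := Finset.mem_sdiff.1 hp
  have hhigh : ∀ v ∈ W, d p < d v → v ∈ D := by
    intro v hv hlt
    by_contra hvD
    exact absurd (hpmax v (Finset.mem_sdiff.2 ⟨hv, hvD⟩)) (by omega)
  have hpr : r ≠ p := fun h => hpD (h ▸ hr)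
  have hDp : D ⊆ W.erase p := fun x hx => Finset.mem_erase.2 ⟨fun h => hpD (h ▸ hx), hDW hx⟩
  have hcard : (W.erase p).card < n := hn ▸ Finset.card_erase_lt_of_mem hpW
  -- every vertex still has a parent after the removal of `p`
  by_cases hY : ∀ v ∈ W, v ≠ r → v ≠ p →
      ∃ u ∈ W, u ≠ p ∧ C.IsCover ({u, v} ∪ I) ∧ d v = d u + 1
  · refine ih _ hcard (hWI.mono_left (Finset.erase_subset _ _)) (hs.mono (Finset.erase_subset _ _))
      ?_ hDp hr hD2 hD hmin heven rfl
    intro v hv hvr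
    obtain ⟨hvp, hvW⟩ := Finset.mem_erase.1 hv
    obtain ⟨u, hu, hup, h⟩ := hY v hvW hvr hvp
    exact ⟨u, Finset.mem_erase.2 ⟨hup, hu⟩, h⟩
  push Not at hY
  have hchild : ∀ v ∈ W, v ≠ r →
      (∀ u ∈ W, u ≠ p → C.IsCover ({u, v} ∪ I) → d v ≠ d u + 1) →
      v ∈ D ∧ C.IsCover ({p, v} ∪ I) := by
    intro v hv hvr hno
    obtain ⟨u, hu, huv, h⟩ := hd v hv hvr
    by_cases hup : u = p
    · subst hup
      exact ⟨hhigh v hv (by omega), huv⟩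
    · exact absurd h (hno u hu hup huv)
  obtain ⟨y, hyW, hyr, hyp, hyno⟩ := hY
  obtain ⟨hyD, hpy⟩ := hchild y hyW hyr hyno
  have hdy : d p < d y := by
    obtain ⟨u, hu, huv, h⟩ := hd y hyW hyr
    by_cases hup : u = p
    · subst hup
      omega
    · exact absurd h (hyno u hu hup huv)
  -- `y` is the only vertex that loses its parent with `p`, and it is itself not needed as a parent
  have hparent : ∀ v ∈ W, v ≠ r → v ≠ p → v ≠ y →
      ∃ u ∈ W, u ≠ p ∧ u ≠ y ∧ C.IsCover ({u, v} ∪ I) ∧ d v = d u + 1 := by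
    intro v hv hvr hvp hvy
    by_contra! hno
    have hvno : ∀ u ∈ W, u ≠ p → C.IsCover ({u, v} ∪ I) → d v ≠ d u + 1 := by
      intro u hu hup huv h
      refine hno u hu hup ?_ huv h
      rintro rfl
      exact hDedge u hyD v (hhigh v hv (by omega)) huv
    obtain ⟨hvD, hpv⟩ := hchild v hv hvr hvno
    refine hC.not_cover_of_common_neighbor hpD (Finset.disjoint_left.1 hWI hpW)
      (hWI.mono_left hDW) hyD hvD hvy.symm (fun h => ?_) hpy hpv hD hmin
    have := hs {p} (by simpa using hpW) h
    simp at this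
  -- either `y` can be attached to another neighbor `x`, or it is isolated once `p` is gone
  by_cases hx : ∃ x ∈ W, x ≠ p ∧ x ≠ y ∧ C.IsCover ({x, y} ∪ I)
  · obtain ⟨x, hxW, hxp, hxy, hcov⟩ := hx
    refine ih _ hcard (d := Function.update d y (d x + 1))
      (hWI.mono_left (Finset.erase_subset _ _)) (hs.mono (Finset.erase_subset _ _))
      ?_ hDp hr hD2 hD hmin ?_ rfl
    · intro v hv hvr
      obtain ⟨hvp, hvW⟩ := Finset.mem_erase.1 hv
      by_cases hvy : v = y
      · subst hvy
        exact ⟨x, Finset.mem_erase.2 ⟨hxp, hxW⟩, hcov, by simp [hxy]⟩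
      · obtain ⟨u, hu, hup, huy, h, h'⟩ := hparent v hvW hvr hvp hvy
        exact ⟨u, Finset.mem_erase.2 ⟨hup, hu⟩, h, by simp [huy, hvy, h']⟩
    · intro v hv
      by_cases hvy : v = y
      · subst hvy
        rw [Function.update_self, Nat.even_add_one]
        exact fun h => (hpar x hxW v hyW hcov).1 h (heven v hv)
      · rw [Function.update_of_ne hvy]
        exact heven v hv
  · push Not at hx
    have hsub : (W.erase p).erase y ⊆ W :=
      (Finset.erase_subset _ _).trans (Finset.erase_subset _ _)
    refine ih ((W.erase p).erase y).card
      ((Finset.card_le_card (Finset.erase_subset _ _)).trans_lt hcard) (I := insert y I)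
      (D := D.erase y) (d := d) ?_ ?_ ?_ (Finset.erase_subset_erase _ hDp)
      (Finset.mem_erase.2 ⟨hyr.symm, hr⟩) ?_ (hD.mono (by grind)) ?_
      (fun v hv => heven v (Finset.mem_of_mem_erase hv)) rfl
    · rw [Finset.disjoint_insert_right]
      exact ⟨Finset.notMem_erase _ _, hWI.mono_left hsub⟩
    · intro T hT hcov
      have hyT : y ∉ T := fun h => Finset.notMem_erase _ _ (hT h)
      have h1 := hs (insert y T) (Finset.insert_subset hyW (hT.trans hsub))
        (hcov.mono (by grind))
      rw [Finset.card_insert_of_notMem hyT] at h1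
      by_contra! hlt
      obtain ⟨x, rfl⟩ := Finset.card_eq_one.1 (by omega : T.card = 1)
      have hxm : x ∈ (W.erase p).erase y := hT (Finset.mem_singleton_self x)
      simp only [Finset.mem_erase] at hxm
      exact hx x hxm.2.2 hxm.2.1 hxm.1 (hcov.mono (by grind))
    · intro v hv hvr
      simp only [Finset.mem_erase] at hv
      obtain ⟨u, hu, hup, huy, h, h'⟩ := hparent v hv.2.2 hvr hv.2.1 hv.1
      exact ⟨u, by simp [hu, hup, huy], h.mono (by grind), h'⟩
    · rw [Finset.card_erase_of_mem hyD]
      omega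
    · intro D' hD' hcov
      refine hmin (insert y D') ?_ (hcov.mono (by grind))
      rw [Finset.ssubset_iff_of_subset
        (Finset.insert_subset hyD (hD'.subset.trans (Finset.erase_subset _ _)))]
      obtain ⟨x, hx, hxD'⟩ := Finset.exists_of_ssubset hD'
      exact ⟨x, Finset.mem_of_mem_erase hx, by
        simp only [Finset.mem_insert, not_or]
        exact ⟨Finset.ne_of_mem_erase hx, hxD'⟩⟩

end Clutter

/-! ### Splitting off a component -/

lemma SimpleGraph.Reachable.exists_adj_dist_eq {V : Type*} {G : SimpleGraph V} {r v : V}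
    (h : G.Reachable r v) (hne : v ≠ r) : ∃ u, G.Adj u v ∧ G.dist r v = G.dist r u + 1 := by
  obtain ⟨p, hp⟩ := h.symm.exists_walk_length_eq_dist
  cases p with
  | nil => exact absurd rfl hne
  | @cons _ u _ hadj q =>
    refine ⟨u, hadj.symm, ?_⟩
    have h1 := SimpleGraph.dist_le q
    have h2 : G.dist r v ≤ G.dist r u + G.dist u v := (hadj.reachable.symm).dist_triangle_right r
    rw [SimpleGraph.dist_eq_one_iff_adj.2 hadj.symm] at h2
    rw [SimpleGraph.Walk.length_cons] at hp
    rw [SimpleGraph.dist_comm] at hp h1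
    omega

namespace Clutter

variable {V : Type*} [Fintype V] [DecidableEq V]

open Classical in
/-- The side with color `b` of the component of `s` in the graph of the minor over `W`. -/
noncomputable def side (C : Clutter V) (W I : Finset V) (c : V → Bool) (s : V) (b : Bool) :
    Finset V :=
  W.filter fun v => (C.minorGraph W I).Reachable s v ∧ c v = b

open Classical in
/-- The elements of `W` outside the component of `s` in the graph of the minor over `W`. -/
noncomputable def outside (C : Clutter V) (W I : Finset V) (s : V) : Finset V :=
  W.filter fun v => ¬ (C.minorGraph W I).Reachable s v

lemma mem_side {C : Clutter V} {W I : Finset V} {c : V → Bool} {s v : V} {b : Bool} :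
    v ∈ C.side W I c s b ↔ v ∈ W ∧ (C.minorGraph W I).Reachable s v ∧ c v = b := by
  simp [side]

lemma mem_outside {C : Clutter V} {W I : Finset V} {s v : V} :
    v ∈ C.outside W I s ↔ v ∈ W ∧ ¬ (C.minorGraph W I).Reachable s v := by
  simp [outside]

/-- Deleting one side of a component and contracting the other one keeps the covering number at
least two: a cover that consists of elements of one side and at most one element `x` outside the
component becomes, after deleting `x`, a cover inside one side. -/
theorem IsClean.noSmallCover_outside {C : Clutter V} (hC : C.IsClean) {W I : Finset V}
    (hWI : Disjoint W I) (hs : C.NoSmallCover W I) (c : (C.minorGraph W I).Coloring Bool)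
    (s : V) (b : Bool) :
    C.NoSmallCover (C.outside W I s) (I ∪ C.side W I c s b) := by
  classical
  set U := C.side W I c s b with hU
  intro T hT hcov
  by_contra! hlt
  have hTW : ∀ x ∈ T, x ∈ W ∧ ¬ (C.minorGraph W I).Reachable s x :=
    fun x hx => mem_outside.1 (hT hx)
  have hUW : ∀ x ∈ U, x ∈ W ∧ (C.minorGraph W I).Reachable s x ∧ c x = b :=
    fun x hx => mem_side.1 hx
  obtain ⟨D, hDTU, hDmin⟩ := exists_minimal_le_of_wellFoundedLT
    (fun D : Finset V => C.IsCover (D ∪ I)) (T ∪ U) (hcov.mono (by grind))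
  have hDW : D ⊆ W := by
    intro x hx
    rcases Finset.mem_union.1 (hDTU hx) with h | h
    exacts [(hTW x h).1, (hUW x h).1]
  -- no edge joins `T` to the component
  have hno : ∀ x ∈ W, (C.minorGraph W I).Reachable s x → ∀ y ∈ T, ¬ C.IsCover ({x, y} ∪ I) := by
    intro x hxW hx y hy hxy
    have hadj : (C.minorGraph W I).Adj x y := ⟨hs.ne hxW hxy, hxW, (hTW y hy).1, hxy⟩
    exact (hTW y hy).2 (hx.trans hadj.reachable)
  have hDT : (D ∩ T).card ≤ 1 := (Finset.card_le_card Finset.inter_subset_right).trans (by omega)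
  have hsplit : (D ∩ T).card + (D \ T).card = D.card := Finset.card_inter_add_card_sdiff D T
  have hDU : ∀ x ∈ D \ T, x ∈ U := by
    intro x hx
    rw [Finset.mem_sdiff] at hx
    exact (Finset.mem_union.1 (hDTU hx.1)).resolve_left hx.2
  have hD2 := hs D hDW hDmin.prop
  have hD0 : 2 ≤ (D \ T).card := by
    by_contra! hlt0
    obtain ⟨x, hx⟩ := Finset.card_eq_one.1 (by omega : (D ∩ T).card = 1)
    obtain ⟨v, hv⟩ := Finset.card_eq_one.1 (by omega : (D \ T).card = 1)
    have hvU := hUW v (hDU v (by rw [hv]; simp))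
    have hxT : x ∈ T := Finset.mem_of_mem_inter_right (by rw [hx]; simp : x ∈ D ∩ T)
    refine hno v hvU.1 hvU.2.1 x hxT (hDmin.prop.mono ?_)
    rw [← Finset.sdiff_union_inter D T, hx, hv]
    rfl
  obtain ⟨r, hr⟩ : (D \ T).Nonempty := Finset.card_pos.1 (by omega)
  have hrU := hUW r (hDU r hr)
  -- delete the element of `D` outside the component, if there is one, and keep the component only
  refine hC.not_cover_of_even (W := W.filter fun v => (C.minorGraph W I).Reachable s v)
    (I := I ∪ (D ∩ T)) (D := D \ T) (r := r) (d := (C.minorGraph W I).dist r) ?_ ?_ ?_ ?_ hr hD0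
    (hDmin.prop.mono (by grind)) ?_ ?_
  · rw [Finset.disjoint_union_right]
    refine ⟨hWI.mono_left (Finset.filter_subset _ _), Finset.disjoint_left.2 fun x hx hx' => ?_⟩
    exact (hTW x (Finset.mem_of_mem_inter_right hx')).2 (Finset.mem_filter.1 hx).2
  · intro S hS hScov
    by_contra! hSlt
    have hSub : S ∪ (D ∩ T) ⊆ W := Finset.union_subset (hS.trans (Finset.filter_subset _ _))
      (Finset.inter_subset_left.trans hDW)
    have h2 := hs _ hSub (hScov.mono (by grind))
    have h3 := Finset.card_union_le S (D ∩ T)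
    obtain ⟨x, hx⟩ := Finset.card_eq_one.1 (by omega : (D ∩ T).card = 1)
    obtain ⟨v, rfl⟩ := Finset.card_eq_one.1 (by omega : S.card = 1)
    have hv := Finset.mem_filter.1 (hS (Finset.mem_singleton_self v))
    have hxT : x ∈ T := Finset.mem_of_mem_inter_right (by rw [hx]; simp : x ∈ D ∩ T)
    exact hno v hv.1 hv.2 x hxT (hScov.mono (by rw [hx]; grind))
  · intro v hv hvr
    obtain ⟨hvW, hv⟩ := Finset.mem_filter.1 hv
    obtain ⟨u, hadj, h⟩ := (hrU.2.1.symm.trans hv).exists_adj_dist_eq hvr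
    exact ⟨u, Finset.mem_filter.2 ⟨hadj.2.1, hv.trans hadj.reachable.symm⟩,
      hadj.2.2.2.mono (by grind), h⟩
  · intro x hx
    have := hUW x (hDU x hx)
    exact Finset.mem_filter.2 ⟨this.1, this.2.1⟩
  · intro D' hD' hcov'
    have hsub : D' ∪ (D ∩ T) ⊆ D :=
      Finset.union_subset (hD'.subset.trans Finset.sdiff_subset) Finset.inter_subset_left
    obtain ⟨x, hx, hxD'⟩ := Finset.exists_of_ssubset hD'
    rw [Finset.mem_sdiff] at hx
    have := hDmin.le_of_le (y := D' ∪ (D ∩ T)) (hcov'.mono (by grind)) hsub hx.1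
    grind
  · intro v hv
    have hvU := hUW v (hDU v hv)
    obtain ⟨p, hp⟩ := (hrU.2.1.symm.trans hvU.2.1).exists_walk_length_eq_dist
    rw [← hp, c.even_length_iff_congr p, hrU.2.2, hvU.2.2]

/-- A stable set of the graph of the minor whose complement is not a cover. If this graph is
bipartite without isolated vertices, such a set is a union of sides of components, one of each, and
a member of the minor. -/
structure IsStableMember (C : Clutter V) (W I A : Finset V) : Prop where
  subset : A ⊆ W
  stable : ∀ u ∈ A, ∀ v ∈ A, ¬ C.IsCover ({u, v} ∪ I)
  not_isCover : ¬ C.IsCover ((W \ A) ∪ I)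

/-- After one side of a component has been deleted and the other one has been contracted, a stable
member of the minor gives a stable member of the original clutter by adding the second side. -/
lemma IsStableMember.union_side {C : Clutter V} {W I A : Finset V} (hs : C.NoSmallCover W I)
    (c : (C.minorGraph W I).Coloring Bool) (s : V) (b : Bool)
    (hA : C.IsStableMember (C.outside W I s) (I ∪ C.side W I c s b) A) :
    C.IsStableMember W I (A ∪ C.side W I c s (!b)) := by
  have hA' : ∀ x ∈ A, x ∈ W ∧ ¬ (C.minorGraph W I).Reachable s x :=
    fun x hx => mem_outside.1 (hA.subset hx)
  have hcross : ∀ u ∈ A, ∀ v ∈ C.side W I c s (!b), ¬ C.IsCover ({u, v} ∪ I) := by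
    intro u hu v hv huv
    obtain ⟨hvW, hv, -⟩ := mem_side.1 hv
    have hadj : (C.minorGraph W I).Adj u v := ⟨hs.ne (hA' u hu).1 huv, (hA' u hu).1, hvW, huv⟩
    exact (hA' u hu).2 (hv.trans hadj.reachable.symm)
  refine ⟨?_, ?_, fun h => hA.not_isCover (h.mono ?_)⟩
  · refine Finset.union_subset (fun x hx => (hA' x hx).1) fun x hx => (mem_side.1 hx).1
  · intro u hu v hv huv
    rcases Finset.mem_union.1 hu with hu | hu <;> rcases Finset.mem_union.1 hv with hv | hv
    · exact hA.stable u hu v hv (huv.mono (by grind))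
    · exact hcross u hu v hv huv
    · exact hcross v hv u hu (by rwa [Finset.pair_comm])
    · obtain ⟨huW, -, hu⟩ := mem_side.1 hu
      obtain ⟨hvW, -, hv⟩ := mem_side.1 hv
      exact c.valid (⟨hs.ne huW huv, huW, hvW, huv⟩ : (C.minorGraph W I).Adj u v) (hu.trans hv.symm)
  · intro x hx
    simp only [Finset.mem_union, Finset.mem_sdiff, mem_side, mem_outside] at hx ⊢
    by_cases hr : (C.minorGraph W I).Reachable s x
    · have : c x = b ∨ c x = !b := by cases c x <;> cases b <;> simp
      tauto
    · grind

/-- The signed sum of the weights over the elements of `W`, where the elements outside `A` are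
counted negatively. -/
noncomputable def signedSum (W A : Finset V) (w : V → ℝ) : ℝ :=
  ∑ v ∈ W, if v ∈ A then w v else - w v

/-- The signed sum over the component and the signed sum over the remaining elements. -/
lemma signedSum_union_side {C : Clutter V} {W I A : Finset V}
    (c : (C.minorGraph W I).Coloring Bool) (s : V) (b : Bool) (w : V → ℝ)
    (hA : A ⊆ C.outside W I s) :
    signedSum W (A ∪ C.side W I c s (!b)) w =
      (∑ v ∈ C.side W I c s (!b), w v - ∑ v ∈ C.side W I c s b, w v) +
        signedSum (C.outside W I s) A w := by
  classical
  have hA' : ∀ x ∈ A, x ∈ W ∧ ¬ (C.minorGraph W I).Reachable s x :=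
    fun x hx => mem_outside.1 (hA hx)
  have h1 : W = (C.side W I c s (!b) ∪ C.side W I c s b) ∪ C.outside W I s := by
    ext x
    simp only [Finset.mem_union, mem_side, mem_outside]
    cases c x <;> cases b <;> simp <;> tauto
  have hd1 : Disjoint (C.side W I c s (!b) ∪ C.side W I c s b) (C.outside W I s) := by
    rw [Finset.disjoint_left]
    intro x
    simp only [Finset.mem_union, mem_side, mem_outside]
    tauto
  have hd2 : Disjoint (C.side W I c s (!b)) (C.side W I c s b) := by
    rw [Finset.disjoint_left]
    intro x
    simp only [mem_side]
    cases c x <;> cases b <;> simp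
  rw [signedSum, Finset.sum_congr h1 fun _ _ => rfl, Finset.sum_union hd1, Finset.sum_union hd2,
    signedSum, sub_eq_add_neg, ← Finset.sum_neg_distrib]
  refine congrArg₂ _ (congrArg₂ _ ?_ ?_) ?_
  · refine Finset.sum_congr rfl fun x hx => ?_
    rw [if_pos (Finset.mem_union_right _ hx)]
  · refine Finset.sum_congr rfl fun x hx => ?_
    rw [if_neg]
    rw [Finset.mem_union, not_or]
    exact ⟨fun h => (hA' x h).2 (mem_side.1 hx).2.1,
      fun h => Finset.disjoint_left.1 hd2 h hx⟩
  · refine Finset.sum_congr rfl fun x hx => ?_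
    have : x ∉ C.side W I c s (!b) := fun h => (mem_outside.1 hx).2 (mem_side.1 h).2.1
    simp [this]

lemma disjoint_outside {C : Clutter V} {W I : Finset V} (hWI : Disjoint W I) (c : V → Bool)
    (s : V) (b : Bool) : Disjoint (C.outside W I s) (I ∪ C.side W I c s b) := by
  rw [Finset.disjoint_left]
  intro x hx hx'
  obtain ⟨hxW, hx⟩ := mem_outside.1 hx
  rcases Finset.mem_union.1 hx' with h | h
  · exact Finset.disjoint_left.1 hWI hxW h
  · exact hx (mem_side.1 h).2.1

/-- For every weight function there is a stable member of at least half the total weight: delete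
the lighter side of a component and contract the heavier side. -/
theorem IsClean.exists_isStableMember {C : Clutter V} (hC : C.IsClean) (w : V → ℝ)
    {W I : Finset V} (hWI : Disjoint W I) (hs : C.NoSmallCover W I) :
    ∃ A, C.IsStableMember W I A ∧ 0 ≤ signedSum W A w := by
  induction hn : W.card using Nat.strong_induction_on generalizing W I with
  | _ n ih =>
  rcases W.eq_empty_or_nonempty with rfl | ⟨s, hsW⟩
  · refine ⟨∅, ⟨subset_rfl, by simp, fun h => ?_⟩, by simp [signedSum]⟩
    have := hs ∅ subset_rfl (by simpa using h)
    simp at this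
  · let c : (C.minorGraph W I).Coloring Bool :=
      (hC.minorGraph_colorable hWI hs).toColoring (by simp)
    obtain ⟨b, hb⟩ : ∃ b, 0 ≤ ∑ v ∈ C.side W I c s (!b), w v - ∑ v ∈ C.side W I c s b, w v := by
      rcases le_total (∑ v ∈ C.side W I c s true, w v) (∑ v ∈ C.side W I c s false, w v) with h | h
      · exact ⟨true, by simpa using h⟩
      · exact ⟨false, by simpa using h⟩
    have hlt : (C.outside W I s).card < n := by
      rw [← hn]
      refine Finset.card_lt_card ((Finset.ssubset_iff_of_subset
        fun x hx => (mem_outside.1 hx).1).2 ⟨s, hsW, fun h => ?_⟩)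
      exact (mem_outside.1 h).2 (SimpleGraph.Reachable.refl s)
    obtain ⟨A, hA, hsum⟩ := ih _ hlt (disjoint_outside hWI c s b)
      (hC.noSmallCover_outside hWI hs c s b) rfl
    refine ⟨_, hA.union_side hs c s b, ?_⟩
    rw [signedSum_union_side c s b w hA.subset]
    exact add_nonneg hb hsum

/-- The strict form: the sides of a component on which the weights do not balance contribute a
positive amount. -/
theorem IsClean.exists_isStableMember_pos {C : Clutter V} (hC : C.IsClean) (w : V → ℝ)
    {W I : Finset V} (hWI : Disjoint W I) (hs : C.NoSmallCover W I)
    (c : (C.minorGraph W I).Coloring Bool) (s : V)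
    (hw : ∑ v ∈ C.side W I c s true, w v ≠ ∑ v ∈ C.side W I c s false, w v) :
    ∃ A, C.IsStableMember W I A ∧ 0 < signedSum W A w := by
  obtain ⟨b, hb⟩ : ∃ b, 0 < ∑ v ∈ C.side W I c s (!b), w v - ∑ v ∈ C.side W I c s b, w v := by
    rcases lt_or_gt_of_ne hw with h | h
    · exact ⟨true, by simpa using h⟩
    · exact ⟨false, by simpa using h⟩
  obtain ⟨A, hA, hsum⟩ := hC.exists_isStableMember w (disjoint_outside hWI c s b)
      (hC.noSmallCover_outside hWI hs c s b)
  refine ⟨_, hA.union_side hs c s b, ?_⟩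
  rw [signedSum_union_side c s b w hA.subset]
  exact add_pos_of_pos_of_nonneg hb hsum

end Clutter

/-! ### Centered sets of cube points and uniqueness of the cuboid -/

/-- A point lies in the interior of the convex hull of a set `P` if every nonzero linear functional
is larger at some point of `P`. -/
lemma mem_interior_convexHull_of_forall_exists_pos {ι : Type*} [Fintype ι] {P : Set (ι → ℝ)}
    {x : ι → ℝ} (hne : P.Nonempty)
    (h : ∀ γ : ι → ℝ, γ ≠ 0 → ∃ p ∈ P, 0 < ∑ i, γ i * (p i - x i)) :
    x ∈ interior (convexHull ℝ P) := by
  classical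
  have hlin : ∀ f : (ι → ℝ) →ₗ[ℝ] ℝ, f ≠ 0 → ∃ p ∈ P, f x < f p := by
    intro f hf
    have hsum : ∀ y, f y = ∑ i, f (fun j => if i = j then 1 else 0) * y i := by
      intro y
      rw [f.pi_apply_eq_sum_univ]
      simp [mul_comm]
    obtain ⟨p, hp, hpos⟩ := h (fun i => f (fun j => if i = j then 1 else 0)) (by
      intro h0
      apply hf
      refine LinearMap.ext fun y => ?_
      rw [hsum]
      simp [fun i => congrFun h0 i])
    refine ⟨p, hp, sub_pos.1 ?_⟩
    rw [← map_sub, hsum]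
    exact hpos
  by_contra hx
  -- a hyperplane that separates `x` from the interior supports the whole convex hull at `x`
  by_cases hint : (interior (convexHull ℝ P)).Nonempty
  · obtain ⟨f, hf⟩ := geometric_hahn_banach_open_point (convex_convexHull ℝ P).interior
      isOpen_interior hx
    obtain ⟨a, ha⟩ := hint
    obtain ⟨p, hp, hlt⟩ := hlin f.toLinearMap (by
      intro h0
      have h1 := hf a ha
      have h2 : ∀ y, f y = 0 := fun y => LinearMap.congr_fun h0 y
      simp [h2] at h1)
    have hcl : p ∈ closure (interior (convexHull ℝ P)) := by
      rw [(convex_convexHull ℝ P).closure_interior_eq_closure_of_nonempty_interior ⟨a, ha⟩]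
      exact subset_closure (subset_convexHull ℝ P hp)
    have hle : p ∈ {y | f y ≤ f x} :=
      closure_minimal (fun y hy => (hf y hy).le) (isClosed_le f.continuous continuous_const) hcl
    exact absurd hlt (not_lt.2 hle)
  -- if the interior is empty, then some nonzero functional is constant on `P`
  · rw [interior_convexHull_nonempty_iff_affineSpan_eq_top,
      AffineSubspace.affineSpan_eq_top_iff_vectorSpan_eq_top_of_nonempty ℝ _ _ hne] at hint
    obtain ⟨f, hf, hker⟩ := Submodule.exists_le_ker_of_lt_top _ (lt_top_iff_ne_top.2 hint)
    obtain ⟨p, hp, hlt⟩ := hlin f hf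
    obtain ⟨q, hq, hlt'⟩ := hlin (-f) (neg_ne_zero.2 hf)
    have h0 : f (p -ᵥ q) = 0 := hker (vsub_mem_vectorSpan ℝ hp hq)
    simp only [vsub_eq_sub, map_sub, LinearMap.neg_apply] at h0 hlt'
    linarith

/-- Every open halfspace whose boundary contains the center of the cube contains a point of `S`. -/
def IsCentered {n : ℕ} (S : Finset (Fin n → Bool)) : Prop :=
  ∀ γ : Fin n → ℝ, γ ≠ 0 → ∃ p ∈ S, 0 < ∑ i, γ i * (cubePoint p i - 1 / 2)

lemma IsCentered.mem_interior {n : ℕ} {S : Finset (Fin n → Bool)} (h : IsCentered S)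
    (hne : S.Nonempty) : (fun _ => (1 / 2 : ℝ)) ∈ interior (cubeHull S) := by
  refine mem_interior_convexHull_of_forall_exists_pos (hne.to_set.image _) fun γ hγ => ?_
  obtain ⟨p, hp, hpos⟩ := h γ hγ
  exact ⟨_, ⟨p, hp, rfl⟩, hpos⟩

/-- Any two coordinates of a centered set take all four pairs of values. -/
lemma IsCentered.exists_eq_eq {n : ℕ} {S : Finset (Fin n → Bool)} (h : IsCentered S) {i j : Fin n}
    (hij : i ≠ j) (a b : Bool) : ∃ p ∈ S, p i = a ∧ p j = b := by
  let sgn : Bool → ℝ := fun a => if a then 1 else -1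
  have hsgn : ∀ a e : Bool, sgn a * ((if e then 1 else 0) - 1 / 2) =
      if e = a then 1 / 2 else -1 / 2 := by
    intro a e
    cases a <;> cases e <;> norm_num [sgn]
  obtain ⟨p, hp, hpos⟩ := h (Pi.single i (sgn a) + Pi.single j (sgn b)) (by
    intro h0
    have := congrFun h0 i
    cases a <;> simp [hij, sgn] at this)
  refine ⟨p, hp, ?_⟩
  simp only [Pi.add_apply, add_mul, Finset.sum_add_distrib, Pi.single_apply, ite_mul, zero_mul,
    Finset.sum_ite_eq', Finset.mem_univ, if_true, cubePoint, hsgn] at hpos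
  by_contra hno
  rw [not_and_or] at hno
  split_ifs at hpos <;> norm_num at hpos
  tauto

/-- A point of a set that has the center in the interior of its convex hull has positive weight in
some convex combination of the center: move from the point beyond the center. -/
lemma exists_centerCombinations_pos {n : ℕ} {S : Finset (Fin n → Bool)}
    (h : (fun _ => (1 / 2 : ℝ)) ∈ interior (cubeHull S)) (p : S) :
    ∃ α ∈ centerCombinations S, 0 < α p := by
  classical
  obtain ⟨ε, hε, hmem⟩ : ∃ ε : ℝ, 0 < ε ∧
      (fun _ => (1 / 2 : ℝ)) + ε • ((fun _ => (1 / 2 : ℝ)) - cubePoint p.1) ∈ cubeHull S := by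
    have hcont : ContinuousAt (fun ε : ℝ =>
        (fun _ => (1 / 2 : ℝ)) + ε • ((fun _ => (1 / 2 : ℝ)) - cubePoint p.1)) 0 := by
      fun_prop
    have hev := hcont.eventually (p := fun y => y ∈ cubeHull S) (by
      simpa using mem_interior_iff_mem_nhds.1 h)
    obtain ⟨δ, hδ, hball⟩ := Metric.eventually_nhds_iff.1 hev
    exact ⟨δ / 2, by positivity, hball (by simp [abs_of_pos hδ]; linarith)⟩
  rw [cubeHull, ← Finset.coe_image, Finset.mem_convexHull'] at hmem
  obtain ⟨w, hw0, hw1, hw⟩ := hmem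
  have hinj : Function.Injective (cubePoint (n := n)) := by
    intro x y hxy
    funext i
    have := congrFun hxy i
    cases hx : x i <;> cases hy : y i <;> simp_all [cubePoint]
  rw [Finset.sum_image hinj.injOn, ← Finset.sum_coe_sort] at hw1 hw
  refine ⟨fun q => (w (cubePoint q.1) + if q = p then ε else 0) / (1 + ε),
    ⟨fun q => ?_, ?_, ?_⟩, ?_⟩
  · have := hw0 _ (Finset.mem_image_of_mem _ q.2)
    dsimp only
    split_ifs <;> positivity
  · rw [← Finset.sum_div, Finset.sum_add_distrib, hw1]
    simp only [Finset.sum_ite_eq', Finset.mem_univ, if_true]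
    exact div_self (by positivity)
  · have h1 : ∑ q : S, ((w (cubePoint q.1) + if q = p then ε else 0) / (1 + ε)) • cubePoint q.1 =
        (1 + ε)⁻¹ • (∑ q : S, w (cubePoint q.1) • cubePoint q.1 + ε • cubePoint p.1) := by
      rw [smul_add, Finset.smul_sum, show ε • cubePoint p.1 =
        ∑ q : S, (if q = p then ε else 0) • cubePoint q.1 by simp [ite_smul], Finset.smul_sum,
        ← Finset.sum_add_distrib]
      refine Finset.sum_congr rfl fun q _ => ?_
      rw [smul_smul, smul_smul, ← add_smul]
      congr 1
      field_simp
    rw [h1, hw]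
    funext i
    simp only [Pi.smul_apply, Pi.add_apply, Pi.sub_apply, smul_eq_mul]
    field_simp
    ring
  · have := hw0 _ (Finset.mem_image_of_mem _ p.2)
    simp only [if_true]
    positivity

namespace Clutter

variable {V : Type*} [Fintype V] [DecidableEq V]

/-- The set `f⁻¹(C'_p)`, where `C'_p` is the member of a cuboid that belongs to `p`. -/
def cuboidPreimage {n : ℕ} (f : V → Fin n × Bool) (p : Fin n → Bool) : Finset V :=
  Finset.univ.filter fun v => f v ∈ cuboidMember p

omit [DecidableEq V] in
lemma mem_cuboidPreimage {n : ℕ} {f : V → Fin n × Bool} {p : Fin n → Bool} {v : V} :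
    v ∈ cuboidPreimage f p ↔ p (f v).1 = (f v).2 := by
  simp [cuboidPreimage, cuboidMember]

omit [DecidableEq V] in
lemma cuboidPreimage_injective {n : ℕ} {f : V → Fin n × Bool} (hf : Function.Surjective f) :
    Function.Injective (cuboidPreimage f) := by
  intro p q hpq
  funext i
  obtain ⟨v, hv⟩ := hf (i, p i)
  have : v ∈ cuboidPreimage f q := hpq ▸ mem_cuboidPreimage.2 (by rw [hv])
  rw [mem_cuboidPreimage, hv] at this
  exact this.symm

/-- The members of a duplication of `cuboid(S)` are the sets `f⁻¹(C'_p)` for `p ∈ S`. -/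
lemma isDuplicationVia_cuboid_iff {n : ℕ} {D : Clutter V} {S : Finset (Fin n → Bool)}
    {f : V → Fin n × Bool} : D.IsDuplicationVia (cuboid S) f ↔
      Function.Surjective f ∧ ∀ A, A ∈ D.members ↔ ∃ p ∈ S, cuboidPreimage f p = A := by
  rw [IsDuplicationVia, cuboid, Finset.image_image, Finset.ext_iff]
  simp only [Finset.mem_image]
  rfl

/-- If `S` is centered, then distinct elements of `cuboid(S)` are not duplicates of each other, and
opposite elements are the only complementary ones. So `cuboid(S)` and the pairing of its elements
can be recovered from any duplication. -/
theorem IsDuplicationVia.cubeIsomorphic {n : ℕ} {D : Clutter V} {S S' : Finset (Fin n → Bool)}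
    {f f' : V → Fin n × Bool} (hS : IsCentered S) (hne : S.Nonempty)
    (hf : D.IsDuplicationVia (cuboid S) f) (hf' : D.IsDuplicationVia (cuboid S') f') :
    CubeIsomorphic S S' := by
  rw [isDuplicationVia_cuboid_iff] at hf hf'
  obtain ⟨hsurj, hmem⟩ := hf
  obtain ⟨hsurj', hmem'⟩ := hf'
  have hto : ∀ p ∈ S, ∃ p' ∈ S', ∀ v, p (f v).1 = (f v).2 ↔ p' (f' v).1 = (f' v).2 := by
    intro p hp
    obtain ⟨p', hp', h⟩ := (hmem' _).1 ((hmem _).2 ⟨p, hp, rfl⟩)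
    exact ⟨p', hp', fun v => by rw [← mem_cuboidPreimage, ← mem_cuboidPreimage, h]⟩
  have hfrom : ∀ p' ∈ S', ∃ p ∈ S, ∀ v, p (f v).1 = (f v).2 ↔ p' (f' v).1 = (f' v).2 := by
    intro p' hp'
    obtain ⟨p, hp, h⟩ := (hmem _).1 ((hmem' _).2 ⟨p', hp', rfl⟩)
    exact ⟨p, hp, fun v => by rw [← mem_cuboidPreimage, ← mem_cuboidPreimage, h]⟩
  -- `f` is constant on the fibers of `f'`, so it factors as `g ∘ f'`, with `g x = f (s x)` below
  have hsame : ∀ u v, f' u = f' v → f u = f v := by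
    intro u v huv
    by_cases h1 : (f u).1 = (f v).1
    · obtain ⟨p, hp⟩ := hne
      obtain ⟨p', -, h⟩ := hto p hp
      have h2 := (h u).trans ((by rw [huv] : _ ↔ _).trans (h v).symm)
      rw [h1] at h2
      refine Prod.ext h1 ?_
      revert h2
      cases p (f v).1 <;> cases (f u).2 <;> cases (f v).2 <;> simp
    · obtain ⟨p, hp, hu, hv⟩ := hS.exists_eq_eq h1 (f u).2 (!(f v).2)
      obtain ⟨p', -, h⟩ := hto p hp
      have h2 := (h u).trans ((by rw [huv] : _ ↔ _).trans (h v).symm)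
      simp [hu, hv] at h2
  -- `g` maps opposite elements to opposite elements
  have hopp : ∀ u v, f' v = ((f' u).1, !(f' u).2) → f v = ((f u).1, !(f u).2) := by
    intro u v huv
    have hx : ∀ p ∈ S, (p (f v).1 = (f v).2 ↔ ¬ p (f u).1 = (f u).2) := by
      intro p hp
      obtain ⟨p', -, h⟩ := hto p hp
      rw [h, h, huv]
      cases p' (f' u).1 <;> cases (f' u).2 <;> simp
    by_cases h1 : (f v).1 = (f u).1
    · obtain ⟨p, hp⟩ := hne
      have h2 := hx p hp
      rw [h1] at h2
      refine Prod.ext h1 ?_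
      revert h2
      cases p (f u).1 <;> cases (f u).2 <;> cases (f v).2 <;> simp
    · obtain ⟨p, hp, hv, hu⟩ := hS.exists_eq_eq h1 (f v).2 (f u).2
      exact absurd hu ((hx p hp).1 hv)
  choose s hs using hsurj'
  have hsf : ∀ v, f (s (f' v)) = f v := fun v => hsame _ _ (hs _)
  have hginj : Function.Injective fun x => f (s x) := by
    rw [Finite.injective_iff_surjective]
    intro x
    obtain ⟨v, rfl⟩ := hsurj x
    exact ⟨f' v, hsf v⟩
  have hgopp : ∀ i, f (s (i, false)) = ((f (s (i, true))).1, !(f (s (i, true))).2) :=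
    fun i => hopp _ _ (by rw [hs, hs]; rfl)
  have hσinj : Function.Injective fun i => (f (s (i, true))).1 := by
    intro i j hij
    by_cases h2 : (f (s (i, true))).2 = (f (s (j, true))).2
    · have := hginj (Prod.ext hij h2)
      simpa using this
    · have h3 : f (s (i, true)) = f (s (j, false)) := by
        rw [hgopp]
        refine Prod.ext hij ?_
        revert h2
        cases (f (s (i, true))).2 <;> cases (f (s (j, true))).2 <;> simp
      simpa using hginj h3
  refine ⟨Equiv.ofBijective _ (Finite.injective_iff_bijective.1 hσinj),
    fun i => !(f (s (i, true))).2, ?_⟩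
  have heq : ∀ p p' : Fin n → Bool, (∀ v, p (f v).1 = (f v).2 ↔ p' (f' v).1 = (f' v).2) →
      (fun i => xor (p (f (s (i, true))).1) (!(f (s (i, true))).2)) = p' := by
    intro p p' h
    funext i
    have h1 := h (s (i, true))
    rw [hs] at h1
    revert h1
    cases p (f (s (i, true))).1 <;> cases (f (s (i, true))).2 <;> cases p' i <;> simp
  ext p'
  rw [Finset.mem_image]
  constructor
  · intro hp'
    obtain ⟨p, hp, h⟩ := hfrom p' hp'
    exact ⟨p, hp, heq p p' h⟩
  · rintro ⟨p, hp, rfl⟩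
    obtain ⟨p', hp', h⟩ := hto p hp
    exact (heq p p' h) ▸ hp'

end Clutter

/-! ### The core and the fractional packings of value two -/

namespace Clutter

variable {V : Type*} [Fintype V] [DecidableEq V]

lemma IsTangled.noSmallCover {C : Clutter V} (hC : C.IsTangled) : C.NoSmallCover Finset.univ ∅ := by
  intro T _ hT
  rw [Finset.union_empty] at hT
  have h : C.coveringNumber ≤ T.card := iInf₂_le T hT
  rw [hC.1] at h
  exact_mod_cast h

lemma IsTangled.card_eq_two {C : Clutter V} (hC : C.IsTangled) {B : Finset V}
    (hB : C.IsMinimumCover B) : B.card = 2 := by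
  refine le_antisymm ?_ (hC.noSmallCover B (Finset.subset_univ _) (by simpa using hB.1))
  have h : (B.card : ℕ∞) ≤ C.coveringNumber := le_iInf₂ fun B' hB' => by exact_mod_cast hB.2 B' hB'
  rw [hC.1] at h
  exact_mod_cast h

lemma IsTangled.exists_cover_pair {C : Clutter V} (hC : C.IsTangled) (v : V) :
    ∃ u, C.IsCover {u, v} := by
  obtain ⟨B, hB, hv⟩ := hC.2 v
  obtain ⟨x, y, -, rfl⟩ := Finset.card_eq_two.1 (hC.card_eq_two hB)
  simp only [Finset.mem_insert, Finset.mem_singleton] at hv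
  rcases hv with rfl | rfl
  · exact ⟨y, by rw [Finset.pair_comm]; exact hB.1⟩
  · exact ⟨x, hB.1⟩

lemma IsTangled.coverGraph_eq {C : Clutter V} (hC : C.IsTangled) :
    C.coverGraph = C.minorGraph Finset.univ ∅ := by
  ext u v
  simp only [coverGraph, minorGraph, Finset.mem_univ, true_and, Finset.union_empty]
  refine and_congr_right fun huv => ⟨fun h => h.1, fun h => ⟨h, fun B hB => ?_⟩⟩
  exact Finset.card_le_two.trans (hC.noSmallCover B (Finset.subset_univ _) (by simpa using hB))

/-- A labeling of the elements of a clutter by the components of the graph of its covers of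
cardinality two, together with the sides of their bipartitions. -/
structure IsSideLabeling (C : Clutter V) {n : ℕ} (f : V → Fin n × Bool) : Prop where
  surjective : Function.Surjective f
  of_cover : ∀ u v, C.IsCover {u, v} → f v = ((f u).1, !(f u).2)
  reachable : ∀ u v, (f u).1 = (f v).1 → (C.minorGraph Finset.univ ∅).Reachable u v

lemma IsTangled.exists_isSideLabeling {C : Clutter V} (hclean : C.IsClean) (hC : C.IsTangled) :
    ∃ f : V → Fin C.rank × Bool, C.IsSideLabeling f := by
  classical
  let c : (C.minorGraph Finset.univ ∅).Coloring Bool :=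
    (hclean.minorGraph_colorable (by simp) hC.noSmallCover).toColoring (by simp)
  let e : C.coverGraph.ConnectedComponent ≃ Fin C.rank := Finite.equivFinOfCardEq rfl
  have hadj : ∀ u v, C.IsCover {u, v} → (C.minorGraph Finset.univ ∅).Adj u v := fun u v h =>
    ⟨hC.noSmallCover.ne (Finset.mem_univ u) (by simpa using h), by simp, by simp, by simpa using h⟩
  have hcov : ∀ u v, C.IsCover {u, v} → (e (C.coverGraph.connectedComponentMk v), c v) =
      (e (C.coverGraph.connectedComponentMk u), !c u) := by
    intro u v h
    refine Prod.ext (congrArg e (SimpleGraph.ConnectedComponent.sound ?_)) ?_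
    · rw [hC.coverGraph_eq]
      exact (hadj u v h).reachable.symm
    · have := c.valid (hadj u v h)
      revert this
      cases c u <;> cases c v <;> simp
  refine ⟨fun v => (e (C.coverGraph.connectedComponentMk v), c v), ?_, hcov, fun u v h => ?_⟩
  · rintro ⟨i, b⟩
    obtain ⟨v, hv⟩ := (e.symm i).exists_rep
    have hv' : e (C.coverGraph.connectedComponentMk v) = i := by
      rw [show C.coverGraph.connectedComponentMk v = e.symm i from hv, e.apply_symm_apply]
    by_cases hb : c v = b
    · exact ⟨v, Prod.ext hv' hb⟩
    · obtain ⟨u, hu⟩ := hC.exists_cover_pair v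
      refine ⟨u, (hcov v u (by rwa [Finset.pair_comm])).trans (Prod.ext hv' ?_)⟩
      revert hb
      cases c v <;> cases b <;> simp
  · rw [← hC.coverGraph_eq]
    exact SimpleGraph.ConnectedComponent.exact (e.injective h)

/-- A stable set that meets all covers of cardinality two contains exactly one side of every
component. -/
lemma IsSideLabeling.exists_eq_cuboidPreimage {C : Clutter V} {n : ℕ} {f : V → Fin n × Bool}
    (hf : C.IsSideLabeling f) {A : Finset V} (hA : C.IsStableMember Finset.univ ∅ A) :
    ∃ p, A = cuboidPreimage f p := by
  have hst : ∀ u v, C.IsCover {u, v} → (v ∈ A ↔ ¬ u ∈ A) := by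
    intro u v huv
    refine ⟨fun hv hu => hA.stable u hu v hv (by simpa using huv), fun hu => ?_⟩
    by_contra hv
    refine hA.not_isCover (huv.mono fun x hx => ?_)
    simp only [Finset.mem_insert, Finset.mem_singleton] at hx
    rcases hx with rfl | rfl <;> simp [hu, hv]
  have hreach : ∀ u v, (C.minorGraph Finset.univ ∅).Reachable u v →
      ((u ∈ A ↔ v ∈ A) ↔ (f u).2 = (f v).2) := by
    rintro u v ⟨p⟩
    induction p with
    | nil => simp
    | @cons u w v hadj p ih =>
      have hcov : C.IsCover {u, w} := by simpa using hadj.2.2.2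
      have h1 := hst u w hcov
      have h2 := congrArg Prod.snd (hf.of_cover u w hcov)
      rw [h2, h1] at ih
      by_cases hu : u ∈ A <;> by_cases hv : v ∈ A <;> simp only [hu, hv] at ih ⊢ <;>
        revert ih <;> cases (f u).2 <;> cases (f v).2 <;> simp
  choose s hs using hf.surjective
  classical
  refine ⟨fun i => decide (s (i, true) ∈ A), ?_⟩
  ext v
  have h1 := hreach (s ((f v).1, true)) v (hf.reachable _ _ (by rw [hs]))
  rw [hs] at h1
  rw [mem_cuboidPreimage]
  by_cases hu : s ((f v).1, true) ∈ A <;> by_cases hv : v ∈ A <;>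
    simp only [hu, hv] at h1 ⊢ <;> revert h1 <;> cases (f v).2 <;> simp

/-- A union of sides, one of each component, that contains a member is a member. -/
lemma IsSideLabeling.cuboidPreimage_mem {C : Clutter V} {n : ℕ} {f : V → Fin n × Bool}
    (hf : C.IsSideLabeling f) (hC : C.IsTangled) {p : Fin n → Bool}
    (hp : ¬ C.IsCover (cuboidPreimage f p)ᶜ) : cuboidPreimage f p ∈ C.members := by
  obtain ⟨B, hB, hBA⟩ := not_isCover_compl_iff.1 hp
  suffices cuboidPreimage f p ⊆ B by rwa [this.antisymm hBA]
  intro v hv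
  obtain ⟨u, hu⟩ := hC.exists_cover_pair v
  obtain ⟨x, hx⟩ := hu B hB
  simp only [Finset.mem_inter, Finset.mem_insert, Finset.mem_singleton] at hx
  obtain ⟨hxB, rfl | rfl⟩ := hx
  · have h1 := mem_cuboidPreimage.1 (hBA hxB)
    have h2 := mem_cuboidPreimage.1 hv
    rw [hf.of_cover _ _ hu] at h2
    simp [h1] at h2
  · exact hxB

/-- The points of the cube whose unions of sides are members of the clutter. -/
noncomputable def setCore (C : Clutter V) {n : ℕ} (f : V → Fin n × Bool) :
    Finset (Fin n → Bool) :=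
  Finset.univ.filter fun p => cuboidPreimage f p ∈ C.members

lemma mem_setCore {C : Clutter V} {n : ℕ} {f : V → Fin n × Bool} {p : Fin n → Bool} :
    p ∈ C.setCore f ↔ cuboidPreimage f p ∈ C.members := by
  simp [setCore]

lemma IsSideLabeling.exists_mem_setCore {C : Clutter V} {n : ℕ} {f : V → Fin n × Bool}
    (hf : C.IsSideLabeling f) (hC : C.IsTangled) {A : Finset V}
    (hA : C.IsStableMember Finset.univ ∅ A) : ∃ p ∈ C.setCore f, A = cuboidPreimage f p := by
  obtain ⟨p, rfl⟩ := hf.exists_eq_cuboidPreimage hA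
  refine ⟨p, mem_setCore.2 (hf.cuboidPreimage_mem hC fun h => hA.not_isCover ?_), rfl⟩
  simpa [← Finset.compl_eq_univ_sdiff] using h

lemma IsSideLabeling.setCore_nonempty {C : Clutter V} {n : ℕ} {f : V → Fin n × Bool}
    (hf : C.IsSideLabeling f) (hclean : C.IsClean) (hC : C.IsTangled) :
    (C.setCore f).Nonempty := by
  obtain ⟨A, hA, -⟩ := hclean.exists_isStableMember (fun _ => 0) (by simp) hC.noSmallCover
  obtain ⟨p, hp, -⟩ := hf.exists_mem_setCore hC hA
  exact ⟨p, hp⟩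

/-- Put the weight `γ i` on one element of the positive side of the component `i`. -/
lemma IsSideLabeling.isCentered {C : Clutter V} {n : ℕ} {f : V → Fin n × Bool}
    (hf : C.IsSideLabeling f) (hclean : C.IsClean) (hC : C.IsTangled) :
    IsCentered (C.setCore f) := by
  classical
  intro γ hγ
  -- the two sides of the component `j` carry the weights `γ j ≠ 0` and `0`
  obtain ⟨j, hj⟩ := Function.ne_iff.1 hγ
  choose s hs using hf.surjective
  let w : V → ℝ := fun v => ∑ i, if v = s (i, true) then γ i else 0
  have hadj : ∀ {u v}, (C.minorGraph Finset.univ ∅).Adj u v → f v = ((f u).1, !(f u).2) :=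
    fun {u v} h => hf.of_cover _ _ (by simpa using h.2.2.2)
  let c : (C.minorGraph Finset.univ ∅).Coloring Bool :=
    SimpleGraph.Coloring.mk (fun v => (f v).2) fun {u v} h => by
      rw [hadj h]
      simp
  have hreach : ∀ u v, (C.minorGraph Finset.univ ∅).Reachable u v → (f u).1 = (f v).1 := by
    rintro u v ⟨p⟩
    induction p with
    | nil => rfl
    | cons h p ih => rw [← ih, hadj h]
  have hside : ∀ b, ∑ v ∈ C.side Finset.univ ∅ c (s (j, true)) b, w v = if b then γ j else 0 := by
    intro b
    have hmem : ∀ i, s (i, true) ∈ C.side Finset.univ ∅ c (s (j, true)) b ↔ i = j ∧ b = true := by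
      intro i
      rw [mem_side]
      have hc : c (s (i, true)) = true := by
        change (f (s (i, true))).2 = true
        rw [hs]
      refine ⟨fun h => ⟨?_, h.2.2.symm.trans hc⟩, ?_⟩
      · have := hreach _ _ h.2.1
        rw [hs, hs] at this
        exact this.symm
      · rintro ⟨rfl, rfl⟩
        exact ⟨Finset.mem_univ _, SimpleGraph.Reachable.refl _, hc⟩
    rw [Finset.sum_comm]
    simp only [Finset.sum_ite_eq', hmem]
    cases b <;> simp
  obtain ⟨A, hA, hpos⟩ := hclean.exists_isStableMember_pos w (by simp) hC.noSmallCover c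
    (s (j, true)) (by rw [hside, hside]; simpa using hj)
  obtain ⟨p, hp, rfl⟩ := hf.exists_mem_setCore hC hA
  refine ⟨p, hp, ?_⟩
  have hsum : signedSum Finset.univ (cuboidPreimage f p) w =
      2 * ∑ i, γ i * (cubePoint p i - 1 / 2) := by
    have h1 : ∀ v, (if v ∈ cuboidPreimage f p then w v else - w v) =
        ∑ i, if v = s (i, true) then (if v ∈ cuboidPreimage f p then γ i else - γ i) else 0 := by
      intro v
      split_ifs with h
      · rfl
      · rw [← Finset.sum_neg_distrib]
        refine Finset.sum_congr rfl fun i _ => ?_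
        split_ifs <;> simp
    rw [signedSum, Finset.sum_congr rfl fun v _ => h1 v, Finset.sum_comm, Finset.mul_sum]
    refine Finset.sum_congr rfl fun i _ => ?_
    rw [Finset.sum_ite_eq' Finset.univ, if_pos (Finset.mem_univ _)]
    simp only [mem_cuboidPreimage, hs, cubePoint]
    cases p i <;> simp <;> ring
  rw [hsum] at hpos
  linarith

/-- A sum over the members of the clutter, weighted by the packing that belongs to `α`. -/
lemma sum_mul_cuboidPacking {C : Clutter V} {n : ℕ} {S : Finset (Fin n → Bool)}
    {f : V → Fin n × Bool} (hS : ∀ p ∈ S, cuboidPreimage f p ∈ C.members) (α : S → ℝ)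
    (g : Finset V → ℝ) :
    ∑ A : C.members, g A.1 * ∑ p : S, (if cuboidPreimage f p.1 = A.1 then 2 * α p else 0) =
      ∑ p : S, g (cuboidPreimage f p.1) * (2 * α p) := by
  simp only [Finset.mul_sum]
  rw [Finset.sum_comm]
  refine Finset.sum_congr rfl fun p _ => ?_
  rw [Finset.sum_eq_single ⟨cuboidPreimage f p.1, hS p.1 p.2⟩]
  · simp
  · intro A _ hA
    rw [if_neg, mul_zero]
    exact fun h => hA (Subtype.ext h.symm)
  · simp

/-- The sum of the coefficients of the points with value `b` in a given coordinate is `1/2`. -/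
lemma sum_ite_of_mem_centerCombinations {n : ℕ} {S : Finset (Fin n → Bool)} {α : S → ℝ}
    (hα : α ∈ centerCombinations S) (i : Fin n) (b : Bool) :
    ∑ p : S, (if p.1 i = b then α p else 0) = 1 / 2 := by
  obtain ⟨-, h1, h2⟩ := hα
  have h3 : ∑ p : S, (if p.1 i = true then α p else 0) = 1 / 2 := by
    rw [← congrFun h2 i, Finset.sum_apply]
    refine Finset.sum_congr rfl fun p _ => ?_
    simp [cubePoint]
  cases b
  · have h4 : ∑ p : S, (if p.1 i = false then α p else 0) +
        ∑ p : S, (if p.1 i = true then α p else 0) = ∑ p : S, α p := by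
      rw [← Finset.sum_add_distrib]
      refine Finset.sum_congr rfl fun p _ => ?_
      cases p.1 i <;> simp
    linarith
  · exact h3

/-- A convex combination of the center, doubled, is a fractional packing of value two. -/
lemma cuboidPacking_mem {C : Clutter V} {n : ℕ} {S : Finset (Fin n → Bool)}
    {f : V → Fin n × Bool} (hS : ∀ p ∈ S, cuboidPreimage f p ∈ C.members) {α : S → ℝ}
    (hα : α ∈ centerCombinations S) :
    (fun A : C.members => ∑ p : S, if cuboidPreimage f p.1 = A.1 then 2 * α p else 0) ∈
      C.packingsOfValueTwo := by
  classical
  refine ⟨⟨fun A => Finset.sum_nonneg fun p _ => ?_, fun v => ?_⟩, ?_⟩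
  · have := hα.1 p
    split_ifs <;> positivity
  · have h := sum_mul_cuboidPacking hS α fun A => if v ∈ A then 1 else 0
    simp only [ite_mul, one_mul, zero_mul] at h
    rw [Finset.sum_filter, h]
    simp only [mem_cuboidPreimage]
    have h2 := sum_ite_of_mem_centerCombinations hα (f v).1 (f v).2
    simp only [← mul_ite_zero, ← Finset.mul_sum, h2]
    norm_num
  · have h := sum_mul_cuboidPacking hS α fun _ => 1
    simp only [one_mul] at h
    rw [h, ← Finset.mul_sum, hα.2.1, mul_one]

omit [Fintype V] in
/-- A two-element cover is tight for a fractional packing of value two, and no member of positive weight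
contains it. -/
lemma eq_one_and_eq_zero_of_mem_packingsOfValueTwo {C : Clutter V} {y : C.members → ℝ}
    (hy : y ∈ C.packingsOfValueTwo) {u v : V} (huv : C.IsCover {u, v}) :
    ∑ A : C.members with v ∈ A.1, y A = 1 ∧ ∀ A : C.members, u ∈ A.1 → v ∈ A.1 → y A = 0 := by
  obtain ⟨⟨h0, h1⟩, h2⟩ := hy
  have hsum : ∑ A : C.members with u ∈ A.1, y A + ∑ A : C.members with v ∈ A.1, y A =
      2 + ∑ A : C.members with u ∈ A.1 ∧ v ∈ A.1, y A := by
    rw [← h2]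
    simp only [Finset.sum_filter]
    rw [← Finset.sum_add_distrib, ← Finset.sum_add_distrib]
    refine Finset.sum_congr rfl fun A _ => ?_
    have hA : u ∈ A.1 ∨ v ∈ A.1 := by
      obtain ⟨x, hx⟩ := huv A.1 A.2
      simp only [Finset.mem_inter, Finset.mem_insert, Finset.mem_singleton] at hx
      obtain ⟨hx, rfl | rfl⟩ := hx <;> tauto
    by_cases hu : u ∈ A.1 <;> by_cases hv : v ∈ A.1 <;> simp [hu, hv] at hA ⊢
  have hboth : 0 ≤ ∑ A : C.members with u ∈ A.1 ∧ v ∈ A.1, y A :=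
    Finset.sum_nonneg fun A _ => h0 A
  have hu1 := h1 u
  have hv1 := h1 v
  refine ⟨by linarith, fun A hu hv => ?_⟩
  have hz : ∑ A : C.members with u ∈ A.1 ∧ v ∈ A.1, y A = 0 := by linarith
  exact (Finset.sum_eq_zero_iff_of_nonneg fun A _ => h0 A).1 hz A (by simp [hu, hv])

omit [Fintype V] in
lemma mem_core {C : Clutter V} {A : Finset V} :
    A ∈ C.core.members ↔ ∃ h : A ∈ C.members, ∃ y ∈ C.packingsOfValueTwo, 0 < y ⟨A, h⟩ := by
  simp only [core, Finset.mem_filter, and_iff_right_iff_imp]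
  exact fun h => h.1

lemma isStableMember_of_mem_core {C : Clutter V} {A : Finset V} (hA : A ∈ C.core.members) :
    C.IsStableMember Finset.univ ∅ A := by
  obtain ⟨hAC, y, hy, hpos⟩ := mem_core.1 hA
  refine ⟨Finset.subset_univ _, fun u hu v hv huv => ?_, fun h => ?_⟩
  · rw [Finset.union_empty] at huv
    exact hpos.ne' ((eq_one_and_eq_zero_of_mem_packingsOfValueTwo hy huv).2 ⟨A, hAC⟩ hu hv)
  · rw [Finset.union_empty, ← Finset.compl_eq_univ_sdiff] at h
    obtain ⟨x, hx⟩ := h A hAC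
    simp at hx

/-- The core is a duplication of the cuboid of the set core: every point of the set core has
positive weight in a convex combination of the center. -/
lemma IsSideLabeling.isDuplicationVia_setCore {C : Clutter V} {n : ℕ} {f : V → Fin n × Bool}
    (hf : C.IsSideLabeling f) (hC : C.IsTangled)
    (hint : (fun _ => (1 / 2 : ℝ)) ∈ interior (cubeHull (C.setCore f))) :
    C.core.IsDuplicationVia (cuboid (C.setCore f)) f := by
  refine isDuplicationVia_cuboid_iff.2 ⟨hf.surjective, fun A => ⟨fun hA => ?_, ?_⟩⟩
  · obtain ⟨p, hp, h⟩ := hf.exists_mem_setCore hC (isStableMember_of_mem_core hA)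
    exact ⟨p, hp, h.symm⟩
  · rintro ⟨p, hp, rfl⟩
    obtain ⟨α, hα, hpos⟩ := exists_centerCombinations_pos hint ⟨p, hp⟩
    refine mem_core.2 ⟨mem_setCore.1 hp, _, cuboidPacking_mem (fun p => mem_setCore.1) hα, ?_⟩
    refine Finset.sum_pos' (fun q _ => ?_) ⟨⟨p, hp⟩, Finset.mem_univ _, ?_⟩
    · have := hα.1 q
      split_ifs <;> positivity
    · rw [if_pos rfl]
      positivity

/-- A fractional packing of value two is determined by its values on the sets `f⁻¹(C'_p)`. -/
lemma IsDuplicationVia.packing_eq {C : Clutter V} {n : ℕ} {S : Finset (Fin n → Bool)}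
    {f : V → Fin n × Bool} (hf : C.core.IsDuplicationVia (cuboid S) f)
    (hS : ∀ p ∈ S, cuboidPreimage f p ∈ C.members) {y : C.members → ℝ}
    (hy : y ∈ C.packingsOfValueTwo) (A : C.members) :
    y A = ∑ p : S, if cuboidPreimage f p.1 = A.1 then
      2 * (y ⟨cuboidPreimage f p.1, hS p.1 p.2⟩ / 2) else 0 := by
  rw [isDuplicationVia_cuboid_iff] at hf
  by_cases hA : ∃ p ∈ S, cuboidPreimage f p = A.1
  · obtain ⟨p, hp, hpA⟩ := hA
    rw [Finset.sum_eq_single ⟨p, hp⟩]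
    · have : (⟨cuboidPreimage f p, hS p hp⟩ : C.members) = A := Subtype.ext hpA
      rw [if_pos hpA, this]
      ring
    · intro q _ hq
      rw [if_neg]
      exact fun h => hq (Subtype.ext (cuboidPreimage_injective hf.1 (h.trans hpA.symm)))
    · simp
  · rw [Finset.sum_eq_zero]
    · by_contra hne
      have hpos : 0 < y A := lt_of_le_of_ne (hy.1.1 A) (Ne.symm hne)
      exact hA ((hf.2 _).1 (mem_core.2 ⟨A.2, y, hy, hpos⟩))
    · intro p _
      rw [if_neg]
      exact fun h => hA ⟨p.1, p.2, h⟩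

/-- A fractional packing of value two, halved, is a convex combination of the center, because it is
tight at every element. -/
lemma IsDuplicationVia.mem_centerCombinations {C : Clutter V} (hC : C.IsTangled) {n : ℕ}
    {S : Finset (Fin n → Bool)} {f : V → Fin n × Bool}
    (hf : C.core.IsDuplicationVia (cuboid S) f)
    (hS : ∀ p ∈ S, cuboidPreimage f p ∈ C.members) {y : C.members → ℝ}
    (hy : y ∈ C.packingsOfValueTwo) :
    (fun p : S => y ⟨cuboidPreimage f p.1, hS p.1 p.2⟩ / 2) ∈ centerCombinations S := by
  classical
  have hsum := sum_mul_cuboidPacking hS fun p : S => y ⟨cuboidPreimage f p.1, hS p.1 p.2⟩ / 2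
  have hyA := hf.packing_eq hS hy
  simp only [← hyA] at hsum
  refine ⟨fun p => div_nonneg (hy.1.1 _) zero_le_two, ?_, ?_⟩
  · have h := hsum fun _ => 1
    simp only [one_mul] at h
    rw [hy.2, ← Finset.mul_sum] at h
    linarith
  · funext i
    obtain ⟨v, hv⟩ := hf.1 (i, true)
    obtain ⟨u, hu⟩ := hC.exists_cover_pair v
    have h1 := (eq_one_and_eq_zero_of_mem_packingsOfValueTwo hy hu).1
    have h2 := hsum fun A => if v ∈ A then 1 else 0
    simp only [ite_mul, one_mul, zero_mul, ← Finset.sum_filter] at h2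
    rw [h1] at h2
    rw [Finset.sum_filter] at h2
    simp only [mem_cuboidPreimage, hv] at h2
    rw [Finset.sum_apply, eq_div_iff two_ne_zero, mul_comm, h2, Finset.mul_sum]
    refine Finset.sum_congr rfl fun p _ => ?_
    simp only [cubePoint, Pi.smul_apply, smul_eq_mul]
    split_ifs <;> ring

end Clutter

theorem mainTheorem2 {V : Type*} [Fintype V] [DecidableEq V] (C : Clutter V)
    (hclean : C.IsClean) (htangled : C.IsTangled) (r : ℕ) (hr : C.rank = r) :
    ∃ S : Finset (Fin r → Bool),
      (C.core.IsDuplication (Clutter.cuboid S) ∧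
        ∀ S' : Finset (Fin r → Bool),
          C.core.IsDuplication (Clutter.cuboid S') → CubeIsomorphic S S') ∧
      (∀ f : V → Fin r × Bool, C.core.IsDuplicationVia (Clutter.cuboid S) f →
        ∃ Φ : C.packingsOfValueTwo ≃ centerCombinations S,
          ∀ (y : C.packingsOfValueTwo) (p : S) (A : C.members),
            A.1 = Finset.univ.filter (fun v => f v ∈ Clutter.cuboidMember p.1) →
              (Φ y).1 p = y.1 A / 2) ∧
      (affineSpan ℝ (cubeHull S) = ⊤ ∧
        (fun _ => (1 / 2 : ℝ)) ∈ interior (cubeHull S)) := by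
  subst hr
  obtain ⟨f₀, hf₀⟩ := htangled.exists_isSideLabeling hclean
  have hne := hf₀.setCore_nonempty hclean htangled
  have hcen := hf₀.isCentered hclean htangled
  have hint := hcen.mem_interior hne
  have hdup := hf₀.isDuplicationVia_setCore htangled hint
  refine ⟨C.setCore f₀, ⟨⟨f₀, hdup⟩, fun S' ⟨f', hf'⟩ => hdup.cubeIsomorphic hcen hne hf'⟩,
    fun f hf => ?_, ?_, hint⟩
  · have hS : ∀ p ∈ C.setCore f₀, Clutter.cuboidPreimage f p ∈ C.members := fun p hp =>
      (Clutter.mem_core.1 ((Clutter.isDuplicationVia_cuboid_iff.1 hf).2 _ |>.2 ⟨p, hp, rfl⟩)).1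
    refine ⟨⟨fun y => ⟨_, hf.mem_centerCombinations htangled hS y.2⟩,
      fun α => ⟨_, Clutter.cuboidPacking_mem hS α.2⟩, fun y => ?_, fun α => ?_⟩, ?_⟩
    · exact Subtype.ext (funext fun A => (hf.packing_eq hS y.2 A).symm)
    · refine Subtype.ext (funext fun p => ?_)
      dsimp only
      rw [Finset.sum_eq_single p]
      · simp
      · intro q _ hq
        rw [if_neg]
        exact fun h => hq (Subtype.ext (Clutter.cuboidPreimage_injective hf.1 h))
      · simp
    · intro y p A hA
      have : A = ⟨Clutter.cuboidPreimage f p.1, hS p.1 p.2⟩ := Subtype.ext hA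
      rw [this]
      rfl
  · exact (convex_convexHull ℝ _).interior_nonempty_iff_affineSpan_eq_top.1 ⟨_, hint⟩
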